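/- **Theorem 3.1.** Let $\alpha>1$. For $\operatorname{Re} s>1$ put $$K(s)=\mathrm{F.p.}\int_0^\infty \frac{\cos(u^\alpha)}{u}\,e^{-(s-1)u}\,du ,$$ where $\mathrm{F.p.}$ denotes the Hadamard finite part at $u=0$: $\mathrm{F.p.}\int_0^\infty f(u)\,du=L$ means that $f$ is integrable on $(\varepsilon,\infty)$ for every $\varepsilon>0$ and that, for some finite linear combination $D(\varepsilon)$ of functions $\varepsilon^{-a}|\log\varepsilon|^{b}$ with $a,b\ge 0$ not both zero, $\int_\varepsilon^\infty f(u)\,du-D(\varepsilon)\to L$ as $\varepsilon\to0^+$. Let $\gamma$ be the Euler–Mascheroni constant and set $$B_\alpha=(\alpha-1)\,\alpha^{-\frac{\alpha}{\alpha-1}},\qquad A_{\alpha,m}=(-1)^m\alpha^{\frac{1/2-m}{\alpha-1}}\sqrt{\frac{\pi}{2(\alpha-1)}}\quad(m=1,2,3,\dots).$$ The finite part $K(s)$ exists for every $s$ with $\operatorname{Re}s>1$, and: (a) $K$ extends to the whole complex plane as an entire function, again denoted by $K$. (b) $K(1)=-\gamma/\alpha$. (c) As $|t|\to\infty$, $t\in\mathbb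 R$, $$K(1+it)=-\log|t|-\gamma-\frac{\pi i}{2}\operatorname{sgn}(t)+O\!\left(\frac1{|t|^{\alpha}}\right)+O\!\left(\frac{1}{|t|^{\frac{\alpha}{2(\alpha-1)}}}\right),$$ $$K'(1+it)=A_{\alpha,1}|t|^{\frac{1-\alpha/2}{\alpha-1}}\exp\!\left(-i\operatorname{sgn}(t)\left(B_\alpha|t|^{\frac{\alpha}{\alpha-1}}-\frac{\pi}{4}\right)\right)+O\!\left(\frac1{|t|}\right),$$ and, for every integer $m\ge2$, $$K^{(m)}(1+it)=A_{\alpha,m}|t|^{\frac{m-\alpha/2}{\alpha-1}}\exp\!\left(-i\operatorname{sgn}(t)\left(B_\alpha|t|^{\frac{\alpha}{\alpha-1}}-\frac{\pi}{4}\right)\right)+O\!\left(|t|^{\frac{m-3\alpha/2}{\alpha-1}}\right),$$ where the implied constants may depend on $\alpha$ and $m$, and $K^{(m)}$ is the $m$-th complex derivative. -/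

import Mathlib

open Filter Topology MeasureTheory Asymptotics

/-- The basic scale `ε ^ (-a) * |log ε| ^ b`, `p = (a, b)`, used to measure the divergence of an
integral at the end point `0`. For `a, b ≥ 0` not both zero it tends to `∞` as `ε → 0+`. -/
noncomputable def hadamardScale (p : ℝ × ℝ) (ε : ℝ) : ℝ :=
  ε ^ (-p.1) * |Real.log ε| ^ p.2

/-- `HasFinitePart f L` says that the Hadamard finite part `F.p. ∫_0^∞ f(u) du` exists and equals
`L`: the function `f` is integrable on `(ε, ∞)` for every `ε > 0`, and after subtraction of a finite
linear combination of the divergent functions `ε ^ (-a) * |log ε| ^ b` (`a, b ≥ 0`, not both zero)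
the integral `∫_ε^∞ f(u) du` tends to `L` as `ε → 0+`. -/
def HasFinitePart (f : ℝ → ℂ) (L : ℂ) : Prop :=
  (∀ ε : ℝ, 0 < ε → IntegrableOn f (Set.Ioi ε)) ∧
  ∃ (S : Finset (ℝ × ℝ)) (c : ℝ × ℝ → ℂ),
    (∀ p ∈ S, 0 ≤ p.1 ∧ 0 ≤ p.2 ∧ p ≠ 0) ∧
    Tendsto (fun ε : ℝ => (∫ u in Set.Ioi ε, f u) - ∑ p ∈ S, c p * (hadamardScale p ε : ℂ))
      (𝓝[>] 0) (𝓝 L)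

theorem hadamardScale_isLittleO {p q : ℝ × ℝ} (h : toLex q < toLex p) :
    hadamardScale q =o[𝓝[>] 0] hadamardScale p := by
  have hlog : Tendsto (fun ε : ℝ => |Real.log ε|) (𝓝[>] 0) atTop :=
    tendsto_abs_atBot_atTop.comp Real.tendsto_log_nhdsGT_zero
  have hev : ∀ᶠ ε : ℝ in 𝓝[>] 0, 0 < ε ∧ 0 < |Real.log ε| :=
    (eventually_mem_nhdsWithin.mono fun x hx => hx).and (hlog.eventually_gt_atTop 0)
  refine (isLittleO_iff_tendsto' (hev.mono fun ε hε h0 => ?_)).2 ?_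
  · exact absurd h0 (mul_pos (Real.rpow_pos_of_pos hε.1 _) (Real.rpow_pos_of_pos hε.2 _)).ne'
  have key : ∀ᶠ ε : ℝ in 𝓝[>] 0, |Real.log ε| ^ (q.2 - p.2) / ε ^ (-(p.1 - q.1)) =
      hadamardScale q ε / hadamardScale p ε := by
    filter_upwards [hev] with ε hε
    unfold hadamardScale
    rw [Real.rpow_sub hε.2, show -(p.1 - q.1) = -p.1 - -q.1 by ring, Real.rpow_sub hε.1]
    have h1 := (Real.rpow_pos_of_pos hε.1 (-p.1)).ne'
    have h2 := (Real.rpow_pos_of_pos hε.1 (-q.1)).ne'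
    have h3 := (Real.rpow_pos_of_pos hε.2 p.2).ne'
    field_simp
  refine Tendsto.congr' key ?_
  rcases (Prod.Lex.toLex_lt_toLex).1 h with h1 | ⟨h1, h2⟩
  · exact (isLittleO_abs_log_rpow_rpow_nhdsGT_zero (q.2 - p.2)
      (by linarith : -(p.1 - q.1) < 0)).tendsto_div_nhds_zero
  · have : Tendsto (fun ε : ℝ => |Real.log ε| ^ (-(p.2 - q.2))) (𝓝[>] 0) (𝓝 0) :=
      (tendsto_rpow_neg_atTop (by linarith)).comp hlog
    simpa [h1] using this

/-- The finite part is unique, so that `HasFinitePart` determines the value `L`. -/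
theorem HasFinitePart.unique {f : ℝ → ℂ} {L M : ℂ} (hL : HasFinitePart f L)
    (hM : HasFinitePart f M) : L = M := by
  classical
  obtain ⟨-, S, c, hS, hc⟩ := hL
  obtain ⟨-, T, d, hT, hd⟩ := hM
  set e : ℝ × ℝ → ℂ := fun p => if p = 0 then L - M else
    (if p ∈ S then c p else 0) - (if p ∈ T then d p else 0) with he
  set U : Finset (ℝ × ℝ) := insert 0 (S ∪ T) with hU
  have h0 : (0 : ℝ × ℝ) ∉ S ∪ T := by
    intro h
    rcases Finset.mem_union.1 h with h | h
    · exact (hS _ h).2.2 rfl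
    · exact (hT _ h).2.2 rfl
  have hsum : Tendsto (fun ε : ℝ => ∑ p ∈ U, e p * (hadamardScale p ε : ℂ)) (𝓝[>] 0) (𝓝 0) := by
    have h1 := (tendsto_const_nhds (x := L - M) (f := 𝓝[>] (0 : ℝ))).sub (hc.sub hd)
    rw [sub_self] at h1
    refine h1.congr fun ε => ?_
    rw [hU, Finset.sum_insert h0]
    have h2 : ∑ p ∈ S ∪ T, e p * (hadamardScale p ε : ℂ) =
        ∑ p ∈ S, c p * (hadamardScale p ε : ℂ) - ∑ p ∈ T, d p * (hadamardScale p ε : ℂ) := by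
      have hs : ∑ p ∈ S, c p * (hadamardScale p ε : ℂ) =
          ∑ p ∈ S ∪ T, (if p ∈ S then c p else 0) * (hadamardScale p ε : ℂ) := by
        rw [← Finset.sum_subset (Finset.subset_union_left (s₁ := S) (s₂ := T))]
        · exact Finset.sum_congr rfl fun p hp => by simp [hp]
        · intro p _ hp; simp [hp]
      have ht : ∑ p ∈ T, d p * (hadamardScale p ε : ℂ) =
          ∑ p ∈ S ∪ T, (if p ∈ T then d p else 0) * (hadamardScale p ε : ℂ) := by
        rw [← Finset.sum_subset (Finset.subset_union_right (s₁ := S) (s₂ := T))]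
        · exact Finset.sum_congr rfl fun p hp => by simp [hp]
        · intro p _ hp; simp [hp]
      rw [hs, ht, ← Finset.sum_sub_distrib]
      refine Finset.sum_congr rfl fun p hp => ?_
      have : p ≠ 0 := fun h => h0 (h ▸ hp)
      simp only [he, if_neg this]
      ring
    have h3 : e 0 * (hadamardScale 0 ε : ℂ) = L - M := by simp [he, hadamardScale]
    rw [h2, h3]
    ring
  by_contra hne
  have hV : (U.filter fun p => e p ≠ 0).Nonempty :=
    ⟨0, Finset.mem_filter.2 ⟨Finset.mem_insert_self _ _, by simpa [he] using sub_ne_zero.2 hne⟩⟩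
  obtain ⟨p, hp, hmax⟩ := Finset.exists_max_image _ (fun p : ℝ × ℝ => toLex p) hV
  obtain ⟨hpU, hpe⟩ := Finset.mem_filter.1 hp
  have hO : (fun _ : ℝ => (1 : ℂ)) =O[𝓝[>] 0] hadamardScale p := by
    have hone : hadamardScale 0 = fun _ => 1 := by ext; simp [hadamardScale]
    have : hadamardScale 0 =O[𝓝[>] 0] hadamardScale p := by
      by_cases hp0 : p = 0
      · rw [hp0]
      · refine (hadamardScale_isLittleO ?_).isBigO
        have hnn : 0 ≤ p.1 ∧ 0 ≤ p.2 := by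
          rcases Finset.mem_insert.1 hpU with h | h
          · exact absurd h hp0
          rcases Finset.mem_union.1 h with h | h
          · exact ⟨(hS _ h).1, (hS _ h).2.1⟩
          · exact ⟨(hT _ h).1, (hT _ h).2.1⟩
        refine lt_of_le_of_ne (Prod.Lex.toLex_le_toLex'.2 ⟨hnn.1, fun _ => hnn.2⟩) ?_
        exact fun h => hp0 (toLex.injective h).symm
    rw [hone] at this
    exact (isBigO_of_le _ (fun _ => by simp)).trans this
  have hlit : (fun ε : ℝ => ∑ q ∈ U, e q * (hadamardScale q ε : ℂ)) =o[𝓝[>] 0] hadamardScale p :=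
    ((isLittleO_one_iff ℂ).2 hsum).trans_isBigO hO
  have hrest : (fun ε : ℝ => ∑ q ∈ U.erase p, e q * (hadamardScale q ε : ℂ)) =o[𝓝[>] 0]
      hadamardScale p := by
    refine IsLittleO.fun_sum fun q hq => ?_
    obtain ⟨hqp, hqU⟩ := Finset.mem_erase.1 hq
    by_cases hq0 : e q = 0
    · simp [hq0]
    · have hlt : toLex q < toLex p :=
        lt_of_le_of_ne (hmax q (Finset.mem_filter.2 ⟨hqU, hq0⟩)) fun h => hqp (toLex.injective h)
      refine IsLittleO.const_mul_left ?_ _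
      exact (isBigO_of_le _ (fun ε => by simp)).trans_isLittleO (hadamardScale_isLittleO hlt)
  have hmain : (fun ε : ℝ => e p * (hadamardScale p ε : ℂ)) =o[𝓝[>] 0] hadamardScale p := by
    refine (hlit.sub hrest).congr_left fun ε => ?_
    rw [← Finset.add_sum_erase _ _ hpU, add_sub_cancel_right]
  have hself : hadamardScale p =o[𝓝[>] 0] hadamardScale p := by
    refine IsBigO.trans_isLittleO ?_ hmain
    refine IsBigO.of_bound ‖e p‖⁻¹ (Eventually.of_forall fun ε => ?_)
    rw [norm_mul, Complex.norm_real, inv_mul_cancel_left₀ (norm_ne_zero_iff.2 hpe)]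
  have hlog : Tendsto (fun ε : ℝ => |Real.log ε|) (𝓝[>] 0) atTop :=
    tendsto_abs_atBot_atTop.comp Real.tendsto_log_nhdsGT_zero
  have hpos : ∀ᶠ ε : ℝ in 𝓝[>] 0, 0 < hadamardScale p ε := by
    filter_upwards [eventually_mem_nhdsWithin, hlog.eventually_gt_atTop 0] with ε h1 h2
    exact mul_pos (Real.rpow_pos_of_pos h1 _) (Real.rpow_pos_of_pos h2 _)
  exact isLittleO_irrefl (hpos.mono fun ε h => h.ne').frequently hself

/-- The integrand `u⁻¹ cos(u ^ α) e ^ (-(s - 1) u)`, `u > 0`. -/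
noncomputable def kernelK (α : ℝ) (s : ℂ) (u : ℝ) : ℂ :=
  ((Real.cos (u ^ α) / u : ℝ) : ℂ) * Complex.exp (-(s - 1) * (u : ℂ))

/-- `B_α = (α - 1) α ^ (-α / (α - 1))`. -/
noncomputable def constB (α : ℝ) : ℝ :=
  (α - 1) * α ^ (-(α / (α - 1)))

/-- `A_{α,m} = (-1) ^ m α ^ ((1/2 - m) / (α - 1)) √(π / (2 (α - 1)))`. -/
noncomputable def constA (α : ℝ) (m : ℕ) : ℝ :=
  (-1) ^ m * α ^ ((1 / 2 - (m : ℝ)) / (α - 1)) * Real.sqrt (Real.pi / (2 * (α - 1)))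

/-- The oscillatory leading term
`A_{α,m} |t| ^ ((m - α/2) / (α - 1)) exp(-i sgn(t) (B_α |t| ^ (α / (α - 1)) - π/4))`. -/
noncomputable def leadingTerm (α : ℝ) (m : ℕ) (t : ℝ) : ℂ :=
  ((constA α m * |t| ^ (((m : ℝ) - α / 2) / (α - 1)) : ℝ) : ℂ) *
    Complex.exp (-Complex.I *
      ((Real.sign t * (constB α * |t| ^ (α / (α - 1)) - Real.pi / 4) : ℝ) : ℂ))

/-! Put `u = exp x` and `z = s - 1`. Since the cosine is the mean of `exp (i u ^ α)` and its
conjugate, `K` is the mean of `R(z)` and `conj (R (conj z))`, where `R(z)` is the finite part of `∫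
exp (i u ^ α - z u) du / u`. On a ray of small positive argument `d` the factor `exp (i u ^ α)`
decays faster than any `exp (-z u)` can grow, because `α > 1`; so `R`, taken along that ray, is
entire (`hasDerivAt_rayFinitePart`). Turning the real axis into the ray costs only the constant `i
d` coming from the small arc at `0`, and it cancels in the mean (`hasFinitePart_kernelK`). At `z =
0` the substitution `w = -i u ^ α` leaves `∫ exp (-w) dw / w`, whose finite part is governed by
`Γ'(1) = -γ`.

On the line `z = i t`, `t > 0`, the two halves behave differently. For `z = -i t` both exponentials
decay on the ray: replacing `exp (i u ^ α)` by `1` costs `O(t ^ (-α))`, and the `m`-th moment is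
`O(t ^ (-m))`. For `z = i t` there is a stationary point `u₀` with `α u₀ ^ (α - 1) = t`. After
scaling by `u₀` the large parameter is `l = u₀ ^ α` and the phase is `l (exp (α x) - α exp x)`. The
contour runs at height `-d` up to real part `-d`, crosses the saddle `x = 0` along the diagonal, and
leaves at height `d`. The first leg gives `O(l ^ (-m))` for the moments and logarithmic terms for
the finite part. The diagonal gives a Gaussian of size `l ^ (-1/2)` with error `O(l ^ (-3/2))`,
since the next correction is odd (`exists_norm_saddleArc_sub_saddleMain_le`).

In terms of `t`, `u₀ ^ m l ^ (-m)` is of order `t ^ (-m)`. For `m = 1` this exceeds the saddle error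
and yields `O(1 / t)`; for `m ≥ 2` the saddle error dominates. Negative `t` follows by conjugation.
-/

open scoped ComplexConjugate

/-! ### Integrals and growth bounds in the logarithmic variable. -/

section ExponentialMoments

/-- By convexity `c exp p` lies above its tangent of slope `k`, which touches at `log (k / c)`. -/
theorem exists_mul_le_mul_exp_add {k c : ℝ} (hk : 0 < k) (hc : 0 < c) :
    ∃ C, ∀ p : ℝ, k * p ≤ c * Real.exp p + C := by
  refine ⟨k * (Real.log (k / c) - 1), fun p => ?_⟩
  have h := Real.add_one_le_exp (p - Real.log (k / c))
  rw [Real.exp_sub, Real.exp_log (by positivity)] at h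
  have h2 : k * (p - Real.log (k / c) + 1) ≤ k * (Real.exp p / (k / c)) := by gcongr
  have h3 : k * (Real.exp p / (k / c)) = c * Real.exp p := by field_simp
  linarith

theorem integrableOn_exp_mul_sub_exp_Ioi {s c : ℝ} (hs : 0 ≤ s) (hc : 0 < c) (A : ℝ) :
    IntegrableOn (fun p : ℝ => Real.exp (s * p - c * Real.exp p)) (Set.Ioi A) := by
  obtain ⟨C, hC⟩ := exists_mul_le_mul_exp_add (k := s + 1) (by linarith) hc
  refine Integrable.mono' ((integrableOn_exp_mul_Ioi (a := -1) (by norm_num) A).const_mul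
    (Real.exp C)) (by fun_prop) (Eventually.of_forall fun p => ?_)
  rw [Real.norm_eq_abs, Real.abs_exp, ← Real.exp_add, Real.exp_le_exp]
  linarith [hC p]

theorem integrable_exp_mul_sub_exp {s c : ℝ} (hs : 0 < s) (hc : 0 < c) :
    Integrable (fun p : ℝ => Real.exp (s * p - c * Real.exp p)) := by
  rw [← integrableOn_univ, ← Set.Iic_union_Ioi (a := (0 : ℝ)), integrableOn_union]
  refine ⟨?_, integrableOn_exp_mul_sub_exp_Ioi hs.le hc 0⟩
  refine Integrable.mono' (integrableOn_exp_mul_Iic hs 0) (by fun_prop)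
    (Eventually.of_forall fun p => ?_)
  rw [Real.norm_eq_abs, Real.abs_exp, Real.exp_le_exp]
  nlinarith [Real.exp_pos p]

/-- Translation by `log l`. The powers `t ^ (-m)`, `t ^ (-α)`, `l ^ (-m)` and `l ^ (1 - α)` in the
error terms come from this scaling. -/
theorem integral_exp_mul_sub_mul_exp (s c : ℝ) {l : ℝ} (hl : 0 < l) :
    ∫ p : ℝ, Real.exp (s * p - c * l * Real.exp p) =
      l ^ (-s) * ∫ p : ℝ, Real.exp (s * p - c * Real.exp p) := by
  rw [← integral_add_right_eq_self (fun p : ℝ => Real.exp (s * p - c * Real.exp p)) (Real.log l),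
    ← integral_const_mul]
  congr 1 with p
  rw [Real.rpow_def_of_pos hl, ← Real.exp_add, Real.exp_add p, Real.exp_log hl]
  ring_nf

theorem exists_mul_exp_sub_le {a c : ℝ} (ha : 1 < a) (hc : 0 < c) {R : ℝ} (hR : 0 ≤ R) :
    ∃ C, ∀ p : ℝ, R * Real.exp p - c * Real.exp (a * p) ≤ C - Real.exp p := by
  -- From `q` onwards `c * exp ((a - 1) p) ≥ R + 1`, so the faster exponential wins; below `q`
  -- everything is bounded.
  set q := Real.log ((R + 1) / c) / (a - 1)
  refine ⟨(R + 1) * Real.exp q, fun p => ?_⟩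
  rcases le_total p q with h | h
  · have : Real.exp p ≤ Real.exp q := Real.exp_le_exp.2 h
    nlinarith [Real.exp_pos (a * p)]
  · have h1 : Real.exp ((a - 1) * q) ≤ Real.exp ((a - 1) * p) :=
      Real.exp_le_exp.2 (by nlinarith)
    rw [show (a - 1) * q = Real.log ((R + 1) / c) from mul_div_cancel₀ _ (by linarith),
      Real.exp_log (by positivity), div_le_iff₀ hc] at h1
    have h2 : Real.exp (a * p) = Real.exp ((a - 1) * p) * Real.exp p := by
      rw [← Real.exp_add]; ring_nf
    rw [h2]
    nlinarith [Real.exp_pos p, Real.exp_pos q]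

end ExponentialMoments

/-! ### Contour deformation through primitives. -/

section ContourShift

variable {F : ℂ → ℂ}

/-- An entire function has a global primitive, so every later deformation is a telescoping sum of
its values at the corners of the path. -/
theorem HasDerivAt.intervalIntegral_line {P : ℂ → ℂ} (hF : Continuous F)
    (hP : ∀ z, HasDerivAt P (F z) z) (u v : ℂ) (a b : ℝ) :
    ∫ p in a..b, F (u + p * v) * v = P (u + b * v) - P (u + a * v) := by
  refine intervalIntegral.integral_eq_sub_of_hasDerivAt (f := fun p : ℝ => P (u + p * v))
    (fun p _ => ?_) (Continuous.intervalIntegrable (by fun_prop) _ _)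
  have h1 : HasDerivAt (fun p : ℝ => u + (p : ℂ) * v) v p := by
    simpa using ((Complex.ofRealCLM.hasDerivAt (x := p)).mul_const v).const_add u
  exact (hP _).comp p h1

/-- Cauchy's theorem on a half strip. -/
theorem integral_Ioi_sub_integral_Ioi_eq_vertical (hF : Differentiable ℂ F) (A a b : ℝ)
    (ha : IntegrableOn (fun p : ℝ => F (p + Complex.I * a)) (Set.Ioi A))
    (hb : IntegrableOn (fun p : ℝ => F (p + Complex.I * b)) (Set.Ioi A))
    {g : ℝ → ℝ} (hg : Tendsto g atTop (𝓝 0))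
    (hFg : ∀ᶠ p : ℝ in atTop, ∀ y ∈ Set.uIcc a b, ‖F (p + Complex.I * y)‖ ≤ g p) :
    (∫ p in Set.Ioi A, F (p + Complex.I * b)) - ∫ p in Set.Ioi A, F (p + Complex.I * a) =
      -(Complex.I * ∫ y in a..b, F (A + Complex.I * y)) := by
  obtain ⟨P, hP⟩ := hF.isExactOn_univ
  have hP' : ∀ z, HasDerivAt P (F z) z := fun z => hP z trivial
  have hh : ∀ (y : ℝ) (c d : ℝ), ∫ p in c..d, F (p + Complex.I * y) =
      P (d + Complex.I * y) - P (c + Complex.I * y) := fun y c d => by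
    have := HasDerivAt.intervalIntegral_line hF.continuous hP' (Complex.I * y) 1 c d
    simpa [add_comm] using this
  have hv : ∀ (x : ℝ), Complex.I * ∫ y in a..b, F (x + Complex.I * y) =
      P (x + Complex.I * b) - P (x + Complex.I * a) := fun x => by
    have := HasDerivAt.intervalIntegral_line hF.continuous hP' x Complex.I a b
    rw [intervalIntegral.integral_mul_const] at this
    simpa [mul_comm] using this
  have h1 := (intervalIntegral_tendsto_integral_Ioi A hb tendsto_id).sub
    (intervalIntegral_tendsto_integral_Ioi A ha tendsto_id)
  have h2 : Tendsto (fun x : ℝ => Complex.I * ∫ y in a..b, F (x + Complex.I * y)) atTop (𝓝 0) := by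
    refine squeeze_zero_norm' (a := fun x => g x * |b - a|) ?_ (by simpa using hg.mul_const |b - a|)
    filter_upwards [hFg] with x hx
    rw [norm_mul, Complex.norm_I, one_mul]
    exact intervalIntegral.norm_integral_le_of_norm_le_const
      fun y hy => hx y (Set.uIoc_subset_uIcc hy)
  have h3 := h2.sub_const (Complex.I * ∫ y in a..b, F (A + Complex.I * y))
  rw [zero_sub] at h3
  refine tendsto_nhds_unique h1 (h3.congr fun x => ?_)
  simp only [id, hh, hv]
  ring

end ContourShift

/-! ### The regularised exponential integral and Euler's constant. -/

section EulerConstant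

theorem Complex.norm_exp_sub_one_le_mul_exp (w : ℂ) :
    ‖Complex.exp w - 1‖ ≤ ‖w‖ * Real.exp ‖w‖ := by
  simpa using Complex.norm_exp_sub_sum_le_norm_mul_exp w 1

/-- Differentiate the Euler integral at `s = 1`, where `Γ'(1) = -γ`. -/
theorem integral_log_mul_exp_neg :
    ∫ t in Set.Ioi (0 : ℝ), Real.log t * Real.exp (-t) = -Real.eulerMascheroniConstant := by
  have h1 := Complex.hasDerivAt_GammaIntegral (s := 1) (by simp)
  have h2 : Complex.GammaIntegral =ᶠ[𝓝 1] Complex.Gamma := by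
    have : {s : ℂ | 0 < s.re} ∈ 𝓝 (1 : ℂ) :=
      (isOpen_lt continuous_const Complex.continuous_re).mem_nhds (by simp)
    filter_upwards [this] with s hs
    exact (Complex.Gamma_eq_integral hs).symm
  have h3 := h1.unique (Complex.hasDerivAt_Gamma_one.congr_of_eventuallyEq h2)
  simp only [sub_self, Complex.cpow_zero, one_mul] at h3
  have h4 : ∫ t in Set.Ioi (0 : ℝ), ((Real.log t * Real.exp (-t) : ℝ) : ℂ) =
      ((-Real.eulerMascheroniConstant : ℝ) : ℂ) := by
    push_cast at h3 ⊢
    exact h3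
  rw [integral_complex_ofReal] at h4
  exact_mod_cast h4

theorem integral_mul_exp_sub_exp :
    ∫ p : ℝ, p * Real.exp (p - Real.exp p) = -Real.eulerMascheroniConstant := by
  have h := integral_image_eq_integral_abs_deriv_smul MeasurableSet.univ
    (fun x _ => (Real.hasDerivAt_exp x).hasDerivWithinAt)
    (Real.exp_injective.injOn) (fun t => Real.log t * Real.exp (-t))
  rw [Set.image_univ, Real.range_exp, integral_log_mul_exp_neg] at h
  rw [h, setIntegral_univ]
  congr 1 with p
  rw [abs_of_pos (Real.exp_pos _), smul_eq_mul, Real.log_exp, sub_eq_add_neg, Real.exp_add]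
  ring

theorem integrable_mul_exp_sub_exp : Integrable fun p : ℝ => p * Real.exp (p - Real.exp p) := by
  have h := (integrable_exp_mul_sub_exp (s := 3 / 2) (c := 1) (by norm_num) (by norm_num)).add
    (integrable_exp_mul_sub_exp (s := 1 / 2) (c := 1) (by norm_num) (by norm_num))
  refine (h.const_mul 2).mono' (by fun_prop) (Eventually.of_forall fun p => ?_)
  have h1 := Real.add_one_le_exp (p / 2)
  have h2 := Real.add_one_le_exp (-(p / 2))
  have h3 : |p| ≤ 2 * (Real.exp (p / 2) + Real.exp (-(p / 2))) := by
    rw [abs_le]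
    constructor <;> linarith [Real.exp_pos (p / 2), Real.exp_pos (-(p / 2))]
  rw [norm_mul, Real.norm_eq_abs, Real.norm_eq_abs, Real.abs_exp]
  refine (mul_le_mul_of_nonneg_right h3 (Real.exp_pos _).le).trans (le_of_eq ?_)
  simp only [Pi.add_apply]
  rw [mul_assoc, add_mul, ← Real.exp_add, ← Real.exp_add]
  ring_nf

theorem tendsto_mul_exp_atBot : Tendsto (fun A : ℝ => A * Real.exp A) atBot (𝓝 0) := by
  have h := (Real.tendsto_pow_mul_exp_neg_atTop_nhds_zero 1).comp tendsto_neg_atBot_atTop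
  simpa [Function.comp_def] using h.neg

/-- Integration by parts against `p`: the boundary term at `A` joins the compensating `A` to form `A
(1 - exp (-exp A))`, which vanishes in the limit. -/
theorem tendsto_integral_Ioi_exp_neg_exp_add :
    Tendsto (fun A : ℝ => (∫ p in Set.Ioi A, Real.exp (-Real.exp p)) + A) atBot
      (𝓝 (-Real.eulerMascheroniConstant)) := by
  have hint : ∀ A : ℝ, IntegrableOn (fun p : ℝ => Real.exp (-Real.exp p)) (Set.Ioi A) := fun A => by
    simpa using integrableOn_exp_mul_sub_exp_Ioi (s := 0) (c := 1) le_rfl one_pos A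
  have htop : Tendsto (fun p : ℝ => p * Real.exp (-Real.exp p)) atTop (𝓝 0) := by
    have h := (Real.tendsto_pow_mul_exp_neg_atTop_nhds_zero 1).comp Real.tendsto_exp_atTop
    refine squeeze_zero' ?_ ?_ h
    · filter_upwards [eventually_ge_atTop 0] with p hp
      positivity
    · filter_upwards with p
      simp only [Function.comp, pow_one]
      gcongr
      linarith [Real.add_one_le_exp p]
  have hparts : ∀ A : ℝ, (∫ p in Set.Ioi A, Real.exp (-Real.exp p)) + A =
      A * (1 - Real.exp (-Real.exp A)) + ∫ p in Set.Ioi A, p * Real.exp (p - Real.exp p) := by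
    intro A
    have h := integral_Ioi_of_hasDerivAt_of_tendsto' (a := A)
      (f := fun p : ℝ => p * Real.exp (-Real.exp p))
      (f' := fun p => Real.exp (-Real.exp p) - p * Real.exp (p - Real.exp p)) (fun p _ => ?_)
      ((hint A).sub integrable_mul_exp_sub_exp.integrableOn) htop
    · rw [integral_sub (hint A) integrable_mul_exp_sub_exp.integrableOn] at h
      linarith
    · refine ((hasDerivAt_id p).mul (Real.hasDerivAt_exp p).neg.exp).congr_deriv ?_
      rw [sub_eq_add_neg p, Real.exp_add]
      simp
      ring
  have h1 : Tendsto (fun A : ℝ => A * (1 - Real.exp (-Real.exp A))) atBot (𝓝 0) := by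
    refine squeeze_zero_norm' (a := fun A : ℝ => |A * Real.exp A|) ?_
      (by simpa using tendsto_mul_exp_atBot.abs)
    filter_upwards with A
    rw [Real.norm_eq_abs, abs_mul, abs_mul, Real.abs_exp]
    gcongr
    rw [abs_le]
    have := Real.add_one_le_exp (-Real.exp A)
    have : Real.exp (-Real.exp A) ≤ 1 := Real.exp_le_one_iff.2 (by linarith [Real.exp_pos A])
    constructor <;> linarith [Real.exp_pos A]
  have h2 : Tendsto (fun A : ℝ => ∫ p in Set.Ioi A, p * Real.exp (p - Real.exp p)) atBot
      (𝓝 (-Real.eulerMascheroniConstant)) := by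
    rw [← integral_mul_exp_sub_exp]
    exact (aecover_Ioi tendsto_id).integral_tendsto_of_countably_generated integrable_mul_exp_sub_exp
  simpa [hparts] using h1.add h2

/-- In the variable `u = exp x` the vertical segment is a small arc about `0`. It contributes its
opening angle times the value of the integrand's regular factor at `0`. -/
theorem tendsto_integral_vertical {F : ℂ → ℂ} {a b : ℝ} {c : ℂ} (hF : Continuous F) {g : ℝ → ℝ}
    (hg : Tendsto g atBot (𝓝 0))
    (hFg : ∀ᶠ p : ℝ in atBot, ∀ y ∈ Set.uIcc a b, ‖F (p + Complex.I * y) - c‖ ≤ g p) :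
    Tendsto (fun A : ℝ => ∫ y in a..b, F (A + Complex.I * y)) atBot (𝓝 ((b - a) * c)) := by
  rw [tendsto_iff_norm_sub_tendsto_zero]
  refine squeeze_zero_norm' (a := fun x => g x * |b - a|) ?_ (by simpa using hg.mul_const |b - a|)
  filter_upwards [hFg] with x hx
  have : (∫ y in a..b, F (x + Complex.I * y)) - (b - a) * c =
      ∫ y in a..b, (F (x + Complex.I * y) - c) := by
    rw [intervalIntegral.integral_sub (Continuous.intervalIntegrable (by fun_prop) _ _)
      (by simp), intervalIntegral.integral_const]
    simp
  rw [norm_norm, this]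
  exact intervalIntegral.norm_integral_le_of_norm_le_const
    fun y hy => hx y (Set.uIoc_subset_uIcc hy)

theorem norm_exp_neg_exp (p y : ℝ) :
    ‖Complex.exp (-Complex.exp (p + Complex.I * y))‖ = Real.exp (-(Real.cos y * Real.exp p)) := by
  rw [Complex.norm_exp]
  simp [Complex.exp_re, mul_comm]

theorem integrableOn_exp_neg_exp_Ioi {θ : ℝ} (hθ : |θ| < Real.pi / 2) (A : ℝ) :
    IntegrableOn (fun p : ℝ => Complex.exp (-Complex.exp (p + Complex.I * θ))) (Set.Ioi A) := by
  have hc : 0 < Real.cos θ := Real.cos_pos_of_mem_Ioo (abs_lt.1 hθ)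
  refine Integrable.mono' (integrableOn_exp_mul_sub_exp_Ioi (s := 0) (c := Real.cos θ) le_rfl hc A)
    (by fun_prop) (Eventually.of_forall fun p => ?_)
  rw [norm_exp_neg_exp]
  simp

/-- The regularised integral `∫ e⁻ʷ dw / w` along the ray of argument `θ`. -/
theorem tendsto_integral_Ioi_cexp_neg_cexp_add {θ : ℝ} (hθ : |θ| < Real.pi / 2) :
    Tendsto (fun A : ℝ => (∫ p in Set.Ioi A, Complex.exp (-Complex.exp (p + Complex.I * θ))) + A)
      atBot (𝓝 (-Real.eulerMascheroniConstant - Complex.I * θ)) := by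
  set F : ℂ → ℂ := fun x => Complex.exp (-Complex.exp x) with hF
  have hFd : Differentiable ℂ F := by fun_prop
  have hc : 0 < Real.cos θ := Real.cos_pos_of_mem_Ioo (abs_lt.1 hθ)
  have hcos : ∀ y ∈ Set.uIcc 0 θ, Real.cos θ ≤ Real.cos y := fun y hy => by
    rw [← Real.cos_abs θ, ← Real.cos_abs y]
    refine Real.cos_le_cos_of_nonneg_of_le_pi (abs_nonneg _) (by linarith [Real.pi_pos]) ?_
    simpa using Set.abs_sub_left_of_mem_uIcc hy
  have hg : Tendsto (fun p : ℝ => Real.exp (-(Real.cos θ * Real.exp p))) atTop (𝓝 0) :=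
    Real.tendsto_exp_neg_atTop_nhds_zero.comp (Real.tendsto_exp_atTop.const_mul_atTop hc)
  have hshift := fun A : ℝ => integral_Ioi_sub_integral_Ioi_eq_vertical hFd A 0 θ
    (integrableOn_exp_neg_exp_Ioi (by simpa using Real.pi_pos) A)
    (integrableOn_exp_neg_exp_Ioi hθ A) hg (Eventually.of_forall fun p y hy => by
      rw [hF]
      simp only [norm_exp_neg_exp]
      gcongr
      exact hcos y hy)
  have hvert := tendsto_integral_vertical (a := 0) (b := θ) (c := 1) hFd.continuous
    (g := fun p => Real.exp p * Real.exp (Real.exp p))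
    (by simpa using Real.tendsto_exp_atBot.mul (Real.tendsto_exp_atBot.rexp))
    (Eventually.of_forall fun p y _ => by
      refine (Complex.norm_exp_sub_one_le_mul_exp _).trans (le_of_eq ?_)
      simp [Complex.norm_exp])
  have hreal := (Complex.continuous_ofReal.tendsto _).comp tendsto_integral_Ioi_exp_neg_exp_add
  have h := hreal.sub (hvert.const_mul Complex.I)
  simp only [Complex.ofReal_neg, Complex.ofReal_zero, sub_zero, mul_one] at h
  refine h.congr fun A => ?_
  have h1 : ∫ p in Set.Ioi A, F (p + Complex.I * (0 : ℝ)) =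
      ((∫ p in Set.Ioi A, Real.exp (-Real.exp p) : ℝ) : ℂ) := by
    rw [← integral_complex_ofReal]
    simp [hF]
  have h2 := hshift A
  rw [h1] at h2
  simp only [Function.comp]
  push_cast
  linear_combination -h2

end EulerConstant

/-! ### The kernel on the rotated ray: integrability and holomorphy in `z`. -/

section Kernel

/-- In the variable `x = log u`, the integrand `u ^ m exp (i μ u ^ α - z u) du / u`. -/
noncomputable def oscKernel (α : ℝ) (m : ℕ) (μ : ℝ) (z x : ℂ) : ℂ :=
  Complex.exp (m * x + Complex.I * μ * Complex.exp (α * x) - z * Complex.exp x)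

/-- An admissible angle of rotation of the contour. -/
noncomputable def tilt (α : ℝ) : ℝ := (α - 1) / (4 * α ^ 2)

variable {α : ℝ}

theorem tilt_pos (hα : 1 < α) : 0 < tilt α := div_pos (by linarith) (by positivity)

theorem mul_tilt_lt (hα : 1 < α) : α * tilt α < 1 / 4 := by
  rw [tilt, mul_div_assoc', div_lt_iff₀ (by positivity)]
  nlinarith

theorem tilt_lt (hα : 1 < α) : tilt α < 1 / 4 := by
  nlinarith [mul_tilt_lt hα, tilt_pos hα]

theorem sin_tilt_pos (hα : 1 < α) : 0 < Real.sin (tilt α) :=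
  Real.sin_pos_of_pos_of_lt_pi (tilt_pos hα) (by linarith [tilt_lt hα, Real.pi_gt_three])

theorem sin_mul_tilt_pos (hα : 1 < α) : 0 < Real.sin (α * tilt α) :=
  Real.sin_pos_of_pos_of_lt_pi (mul_pos (by linarith) (tilt_pos hα))
    (by linarith [mul_tilt_lt hα, Real.pi_gt_three])

@[fun_prop]
theorem differentiable_oscKernel (m : ℕ) (μ : ℝ) (z : ℂ) :
    Differentiable ℂ (oscKernel α m μ z) := by
  unfold oscKernel; fun_prop

@[fun_prop]
theorem continuous_oscKernel (m : ℕ) (μ : ℝ) (z : ℂ) :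
    Continuous (oscKernel α m μ z) := (differentiable_oscKernel m μ z).continuous

theorem norm_oscKernel (m : ℕ) (μ : ℝ) (z : ℂ) (p y : ℝ) :
    ‖oscKernel α m μ z (p + Complex.I * y)‖ =
      Real.exp (m * p - μ * Real.sin (α * y) * Real.exp (α * p) -
        (z.re * Real.cos y - z.im * Real.sin y) * Real.exp p) := by
  rw [oscKernel, Complex.norm_exp]
  congr 1
  have h1 : Complex.exp (α * (p + Complex.I * y)) =
      Real.exp (α * p) * (Real.cos (α * y) + Real.sin (α * y) * Complex.I) := by
    push_cast
    rw [← Complex.exp_mul_I, ← Complex.exp_add]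
    ring_nf
  have h2 : Complex.exp (p + Complex.I * y) =
      Real.exp p * (Real.cos y + Real.sin y * Complex.I) := by
    push_cast
    rw [← Complex.exp_mul_I, ← Complex.exp_add]
    ring_nf
  rw [h1, h2]
  simp only [Complex.add_re, Complex.sub_re, Complex.mul_re, Complex.natCast_re,
    Complex.natCast_im, Complex.ofReal_re, Complex.ofReal_im, Complex.I_re, Complex.I_im,
    Complex.add_im, Complex.mul_im]
  ring

theorem abs_re_mul_cos_sub_im_mul_sin_le (z : ℂ) (y : ℝ) :
    |z.re * Real.cos y - z.im * Real.sin y| ≤ ‖z‖ := by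
  rw [← Real.sqrt_sq_eq_abs, Complex.norm_def]
  apply Real.sqrt_le_sqrt
  rw [Complex.normSq_apply]
  nlinarith [Real.sin_sq_add_cos_sq y, sq_nonneg (z.re * Real.sin y + z.im * Real.cos y)]

/-- Since `α > 1`, the decay in `exp (α p)` absorbs `‖z‖ exp p` with one constant for all `‖z‖ ≤ R`.
This local uniformity permits differentiation under the integral for every `z`. -/
theorem exists_norm_oscKernel_le (hα : 1 < α) {c : ℝ} (hc : 0 < c) {R : ℝ} (hR : 0 ≤ R) :
    ∃ C, ∀ (m : ℕ) (z : ℂ) (p y : ℝ), ‖z‖ ≤ R → c ≤ Real.sin (α * y) →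
      ‖oscKernel α m 1 z (p + Complex.I * y)‖ ≤ Real.exp C * Real.exp (m * p - 1 * Real.exp p) := by
  obtain ⟨C, hC⟩ := exists_mul_exp_sub_le hα hc hR
  refine ⟨C, fun m z p y hz hy => ?_⟩
  rw [norm_oscKernel, ← Real.exp_add, Real.exp_le_exp]
  have h1 := neg_le_of_abs_le ((abs_re_mul_cos_sub_im_mul_sin_le z y).trans hz)
  have h2 := hC p
  nlinarith [mul_le_mul_of_nonneg_right h1 (Real.exp_pos p).le,
    mul_le_mul_of_nonneg_right hy (Real.exp_pos (α * p)).le]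

theorem hasDerivAt_oscKernel (m : ℕ) (μ : ℝ) (z x : ℂ) :
    HasDerivAt (fun z => oscKernel α m μ z x) (-oscKernel α (m + 1) μ z x) z := by
  unfold oscKernel
  refine (((hasDerivAt_id z).mul_const (Complex.exp x)).const_sub
    (m * x + Complex.I * μ * Complex.exp (α * x))).cexp.congr_deriv ?_
  have : ((m + 1 : ℕ) * x + Complex.I * μ * Complex.exp (α * x) - z * Complex.exp x : ℂ) =
    (m * x + Complex.I * μ * Complex.exp (α * x) - z * Complex.exp x) + x := by push_cast; ring
  rw [this, Complex.exp_add _ x]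
  simp

theorem norm_oscKernel_zero_sub_one_le (hα : 1 < α) (μ : ℝ) (z : ℂ) {p : ℝ} (hp : p ≤ 0) (y : ℝ) :
    ‖oscKernel α 0 μ z (p + Complex.I * y) - 1‖ ≤
      (|μ| + ‖z‖) * Real.exp (|μ| + ‖z‖) * Real.exp p := by
  have h : ‖Complex.I * μ * Complex.exp (α * (p + Complex.I * y)) -
      z * Complex.exp (p + Complex.I * y)‖ ≤ (|μ| + ‖z‖) * Real.exp p := by
    refine (norm_sub_le _ _).trans ?_
    simp only [norm_mul, Complex.norm_I, Complex.norm_exp, one_mul]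
    have : Real.exp (α * p) ≤ Real.exp p := Real.exp_le_exp.2 (by nlinarith)
    have := mul_le_mul_of_nonneg_left this (abs_nonneg μ)
    simp
    linarith
  have h0 : oscKernel α 0 μ z (p + Complex.I * y) = Complex.exp (Complex.I * μ *
      Complex.exp (α * (p + Complex.I * y)) - z * Complex.exp (p + Complex.I * y)) := by
    simp [oscKernel]
  rw [h0]
  have hp1 : Real.exp p ≤ 1 := Real.exp_le_one_iff.2 hp
  calc _ ≤ _ := Complex.norm_exp_sub_one_le_mul_exp _
    _ ≤ ((|μ| + ‖z‖) * Real.exp p) * Real.exp (|μ| + ‖z‖) := by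
      gcongr
      exact h.trans (mul_le_of_le_one_right (by positivity) hp1)
    _ = _ := by ring

theorem integrableOn_oscKernel_Ioi (hα : 1 < α) (m : ℕ) (z : ℂ) {y : ℝ}
    (hy : 0 < Real.sin (α * y)) (A : ℝ) :
    IntegrableOn (fun p : ℝ => oscKernel α m 1 z (p + Complex.I * y)) (Set.Ioi A) := by
  obtain ⟨C, hC⟩ := exists_norm_oscKernel_le hα hy (norm_nonneg z)
  exact ((integrableOn_exp_mul_sub_exp_Ioi m.cast_nonneg one_pos A).const_mul (Real.exp C)).mono'
    (by fun_prop) (Eventually.of_forall fun p => hC m z p y le_rfl le_rfl)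

theorem integrable_oscKernel (hα : 1 < α) {m : ℕ} (hm : m ≠ 0) (z : ℂ) {y : ℝ}
    (hy : 0 < Real.sin (α * y)) :
    Integrable (fun p : ℝ => oscKernel α m 1 z (p + Complex.I * y)) := by
  obtain ⟨C, hC⟩ := exists_norm_oscKernel_le hα hy (norm_nonneg z)
  exact ((integrable_exp_mul_sub_exp (by positivity) one_pos).const_mul (Real.exp C)).mono'
    (by fun_prop) (Eventually.of_forall fun p => hC m z p y le_rfl le_rfl)

/-- The integral of `u ^ m exp (i u ^ α - z u) du / u` along the ray of argument `tilt α`. -/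
noncomputable def rayMoment (α : ℝ) (m : ℕ) (z : ℂ) : ℂ :=
  ∫ p : ℝ, oscKernel α m 1 z (p + Complex.I * tilt α)

/-- The finite part of the integral of `exp (i u ^ α - z u) du / u` along the ray of argument
`tilt α`. -/
noncomputable def rayFinitePart (α : ℝ) (z : ℂ) : ℂ :=
  ∫ p : ℝ, (oscKernel α 0 1 z (p + Complex.I * tilt α) - (Set.Iic (0 : ℝ)).indicator 1 p)

theorem integrable_oscKernel_sub_indicator (hα : 1 < α) (z : ℂ) {y : ℝ}
    (hy : 0 < Real.sin (α * y)) :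
    Integrable (fun p : ℝ =>
      oscKernel α 0 1 z (p + Complex.I * y) - (Set.Iic (0 : ℝ)).indicator 1 p) := by
  rw [← integrableOn_univ, ← Set.Iic_union_Ioi (a := (0 : ℝ)), integrableOn_union]
  constructor
  · have h := (integrableOn_exp_mul_Iic one_pos 0).const_mul ((|1| + ‖z‖) * Real.exp (|1| + ‖z‖))
    have h1 : IntegrableOn (fun p : ℝ => oscKernel α 0 1 z (p + Complex.I * y) - 1)
        (Set.Iic 0) := by
      refine h.mono' (by fun_prop) ?_
      filter_upwards [ae_restrict_mem measurableSet_Iic] with p hp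
      simpa using norm_oscKernel_zero_sub_one_le hα 1 z hp y
    exact h1.congr_fun (fun p hp => by simp [Set.indicator_of_mem hp]) measurableSet_Iic
  · exact (integrableOn_oscKernel_Ioi hα 0 z hy 0).congr_fun
      (fun p hp => by simp [Set.indicator, not_le.2 (Set.mem_Ioi.1 hp)]) measurableSet_Ioi

/-- The subtracted `f` does not depend on `z`, so one argument covers the moments (`f = 0`) and the
finite part (`f` the indicator). -/
theorem hasDerivAt_integral_oscKernel_sub (hα : 1 < α) (m : ℕ) {f : ℝ → ℂ}
    (hf : ∀ z, Integrable fun p : ℝ => oscKernel α m 1 z (p + Complex.I * tilt α) - f p) (z : ℂ) :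
    HasDerivAt (fun z => ∫ p : ℝ, (oscKernel α m 1 z (p + Complex.I * tilt α) - f p))
      (-rayMoment α (m + 1) z) z := by
  obtain ⟨C, hC⟩ := exists_norm_oscKernel_le hα (sin_mul_tilt_pos hα)
    (R := ‖z‖ + 1) (by positivity)
  rw [rayMoment, ← integral_neg]
  refine (hasDerivAt_integral_of_dominated_loc_of_deriv_le (Metric.ball_mem_nhds z one_pos)
    (Eventually.of_forall fun w => (hf w).aestronglyMeasurable) (hf z)
    (F' := fun w p => -oscKernel α (m + 1) 1 w (p + Complex.I * tilt α)) (by fun_prop)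
    (Eventually.of_forall fun p w hw => ?_)
    ((integrable_exp_mul_sub_exp (s := (m + 1 : ℕ)) (by positivity) one_pos).const_mul
      (Real.exp C)) (Eventually.of_forall fun p w _ => ?_)).2
  · rw [norm_neg]
    refine hC _ w p _ ?_ le_rfl
    have := norm_sub_norm_le w z
    rw [Metric.mem_ball, dist_eq_norm] at hw
    linarith
  · exact (hasDerivAt_oscKernel m 1 w _).sub_const _

theorem hasDerivAt_rayMoment (hα : 1 < α) {m : ℕ} (hm : m ≠ 0) (z : ℂ) :
    HasDerivAt (rayMoment α m) (-rayMoment α (m + 1) z) z := by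
  have := hasDerivAt_integral_oscKernel_sub hα m (f := fun _ => 0)
    (fun z => by simpa using integrable_oscKernel hα hm z (sin_mul_tilt_pos hα)) z
  simpa only [sub_zero] using! this

theorem hasDerivAt_rayFinitePart (hα : 1 < α) (z : ℂ) :
    HasDerivAt (rayFinitePart α) (-rayMoment α 1 z) z :=
  hasDerivAt_integral_oscKernel_sub hα 0
    (fun z => integrable_oscKernel_sub_indicator hα z (sin_mul_tilt_pos hα)) z

/-- For `A ≤ 0` the indicator integrates to `-A` over `(A, ∞)`. Thus the absolutely convergent
definition agrees with removing the logarithm. -/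
theorem tendsto_integral_Ioi_rayFinitePart (hα : 1 < α) (z : ℂ) :
    Tendsto (fun A : ℝ => (∫ p in Set.Ioi A, oscKernel α 0 1 z (p + Complex.I * tilt α)) + A)
      atBot (𝓝 (rayFinitePart α z)) := by
  refine ((aecover_Ioi tendsto_id).integral_tendsto_of_countably_generated
    (integrable_oscKernel_sub_indicator hα z (sin_mul_tilt_pos hα))).congr' ?_
  filter_upwards [eventually_le_atBot 0] with A hA
  have h1 : IntegrableOn ((Set.Iic (0 : ℝ)).indicator (1 : ℝ → ℂ)) (Set.Ioi A) := by
    rw [integrableOn_indicator_iff measurableSet_Iic, Set.Iic_inter_Ioi]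
    exact integrableOn_const (by simp)
  rw [id, integral_sub (integrableOn_oscKernel_Ioi hα 0 z (sin_mul_tilt_pos hα) _) h1,
    setIntegral_indicator measurableSet_Iic, Set.Ioi_inter_Iic]
  simp [hA]

theorem tendsto_integral_Ioi_rayMoment (hα : 1 < α) {m : ℕ} (hm : m ≠ 0) (z : ℂ) :
    Tendsto (fun A : ℝ => ∫ p in Set.Ioi A, oscKernel α m 1 z (p + Complex.I * tilt α))
      atBot (𝓝 (rayMoment α m z)) :=
  (aecover_Ioi tendsto_id).integral_tendsto_of_countably_generated
    (integrable_oscKernel hα hm z (sin_mul_tilt_pos hα))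

end Kernel

/-! ### The entire extension, its derivatives and its value at `1`. -/

section Extension

variable {α : ℝ}

theorem integrableOn_oscKernel_real (m : ℕ) {z : ℂ} (hz : 0 < z.re) (A : ℝ) :
    IntegrableOn (fun p : ℝ => oscKernel α m 1 z (p + Complex.I * (0 : ℝ))) (Set.Ioi A) := by
  refine (integrableOn_exp_mul_sub_exp_Ioi (s := m) m.cast_nonneg hz A).mono'
    (by fun_prop) (Eventually.of_forall fun p => ?_)
  rw [norm_oscKernel]
  simp

/-- Rotation of the half line onto the ray; the term `I * tilt α` is the small arc at the origin,
where the kernel tends to `1`. -/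
theorem tendsto_integral_Ioi_oscKernel_real (hα : 1 < α) {z : ℂ} (hz : 0 < z.re) :
    Tendsto (fun A : ℝ => (∫ p in Set.Ioi A, oscKernel α 0 1 z (p + Complex.I * (0 : ℝ))) + A)
      atBot (𝓝 (rayFinitePart α z + Complex.I * tilt α)) := by
  have ht := tilt_pos hα
  have hcos : 0 < Real.cos (tilt α) :=
    Real.cos_pos_of_mem_Ioo ⟨by linarith [Real.pi_pos], by linarith [tilt_lt hα, Real.pi_gt_three]⟩
  -- Jordan's inequality gives `sin (α y) ≥ (2 / π) α y`, while `z.im * sin y ≤ |z.im| y`. Both are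
  -- proportional to `y`, so the comparison stays uniform as `y → 0`; it holds once `exp p ≥ C`, and
  -- the decay then comes from `z.re > 0`.
  obtain ⟨C, hC⟩ := exists_mul_exp_sub_le hα (c := 2 / Real.pi * α) (by positivity)
    (abs_nonneg z.im)
  have hg : Tendsto (fun p : ℝ => Real.exp (-(z.re * Real.cos (tilt α) * Real.exp p))) atTop
      (𝓝 0) :=
    Real.tendsto_exp_neg_atTop_nhds_zero.comp
      (Real.tendsto_exp_atTop.const_mul_atTop (mul_pos hz hcos))
  have hshift := fun A : ℝ => integral_Ioi_sub_integral_Ioi_eq_vertical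
    (differentiable_oscKernel 0 1 z) A 0 (tilt α) (integrableOn_oscKernel_real 0 hz A)
    (integrableOn_oscKernel_Ioi hα 0 z (sin_mul_tilt_pos hα) A) hg (by
      filter_upwards [Real.tendsto_exp_atTop.eventually_ge_atTop C] with p hp y hy
      rw [Set.uIcc_of_le ht.le] at hy
      rw [norm_oscKernel, Real.exp_le_exp]
      have h1 : 2 / Real.pi * α * y ≤ Real.sin (α * y) := by
        rw [mul_assoc]
        refine Real.mul_le_sin (mul_nonneg (by linarith) hy.1) ?_
        nlinarith [hy.2, mul_tilt_lt hα, Real.pi_gt_three]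
      have h2 : Real.cos (tilt α) ≤ Real.cos y :=
        Real.cos_le_cos_of_nonneg_of_le_pi hy.1 (by linarith [tilt_lt hα, Real.pi_gt_three]) hy.2
      have h3 : z.im * Real.sin y ≤ |z.im| * y :=
        mul_le_mul (le_abs_self _) (Real.sin_le hy.1)
          (Real.sin_nonneg_of_nonneg_of_le_pi hy.1
            (by linarith [hy.2, tilt_lt hα, Real.pi_gt_three])) (abs_nonneg _)
      have h4 := hC p
      have h5 : 0 ≤ y * (2 / Real.pi * α * Real.exp (α * p) - |z.im| * Real.exp p) :=
        mul_nonneg hy.1 (by linarith)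
      have h6 := mul_le_mul_of_nonneg_right h1 (Real.exp_pos (α * p)).le
      have h7 := mul_le_mul_of_nonneg_right h3 (Real.exp_pos p).le
      have h8 := mul_le_mul_of_nonneg_right (mul_le_mul_of_nonneg_left h2 hz.le)
        (Real.exp_pos p).le
      simp only [Nat.cast_zero, zero_mul, zero_sub]
      linarith)
  have hvert := tendsto_integral_vertical (a := 0) (b := tilt α) (c := 1)
    (continuous_oscKernel (α := α) 0 1 z)
    (by simpa using Real.tendsto_exp_atBot.const_mul ((1 + ‖z‖) * Real.exp (1 + ‖z‖)))
    (by
      filter_upwards [eventually_le_atBot 0] with p hp y _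
      simpa using norm_oscKernel_zero_sub_one_le hα 1 z hp y)
  have h := (tendsto_integral_Ioi_rayFinitePart hα z).add (hvert.const_mul Complex.I)
  simp only [Complex.ofReal_zero, sub_zero, mul_one] at h
  refine h.congr fun A => ?_
  linear_combination hshift A

/-- The entire extension of the finite part. -/
noncomputable def entireK (α : ℝ) (s : ℂ) : ℂ :=
  (rayFinitePart α (s - 1) + conj (rayFinitePart α (conj (s - 1)))) / 2

theorem oscKernel_add_conj (z : ℂ) (p : ℝ) :
    (oscKernel α 0 1 z (p + Complex.I * (0 : ℝ)) +
      conj (oscKernel α 0 1 (conj z) (p + Complex.I * (0 : ℝ)))) / 2 =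
      (Real.cos (Real.exp (α * p)) : ℂ) * Complex.exp (-z * Real.exp p) := by
  simp only [oscKernel, ← Complex.exp_conj, map_sub, map_mul, Complex.conj_conj,
    Complex.conj_ofReal, Complex.conj_I, Nat.cast_zero, zero_mul, zero_add, Complex.ofReal_zero,
    mul_zero, add_zero, Complex.ofReal_one, mul_one]
  simp only [sub_eq_add_neg, Complex.exp_add, Complex.ofReal_cos, Complex.cos, Complex.ofReal_exp, Complex.ofReal_mul]
  ring_nf

theorem kernelK_eq_of_pos (s : ℂ) {u : ℝ} (hu : 0 < u) :
    kernelK α s u = u⁻¹ • ((oscKernel α 0 1 (s - 1) (Real.log u + Complex.I * (0 : ℝ)) +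
      conj (oscKernel α 0 1 (conj (s - 1)) (Real.log u + Complex.I * (0 : ℝ)))) / 2) := by
  rw [oscKernel_add_conj, kernelK, Real.exp_log hu, mul_comm α, ← Real.rpow_def_of_pos hu]
  simp
  ring

theorem hasFinitePart_kernelK (hα : 1 < α) {s : ℂ} (hs : 1 < s.re) :
    HasFinitePart (kernelK α s) (entireK α s) := by
  have hz : 0 < (s - 1).re := by simpa using hs
  have hz' : 0 < (conj (s - 1)).re := by simpa using hs
  set g : ℝ → ℂ := fun p => (oscKernel α 0 1 (s - 1) (p + Complex.I * (0 : ℝ)) +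
      conj (oscKernel α 0 1 (conj (s - 1)) (p + Complex.I * (0 : ℝ)))) / 2 with hg
  have hi := fun A => integrableOn_oscKernel_real (α := α) 0 hz A
  have hi' := fun A => integrableOn_oscKernel_real (α := α) 0 hz' A
  have hi'' : ∀ A, IntegrableOn (fun p : ℝ =>
      conj (oscKernel α 0 1 (conj (s - 1)) (p + Complex.I * (0 : ℝ)))) (Set.Ioi A) := fun A =>
    (hi' A).congr' (Continuous.aestronglyMeasurable
      (Complex.continuous_conj.comp (by fun_prop))) (Eventually.of_forall fun p => by simp)
  have hgi : ∀ A, IntegrableOn g (Set.Ioi A) := fun A => ((hi A).add (hi'' A)).div_const 2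
  -- The only divergent term is `|log ε|`, with coefficient `1`.
  refine ⟨fun ε hε => ?_, {(0, 1)}, fun _ => 1, by simp, ?_⟩
  · refine ((integrableOn_comp_log_Ioi g hε).2 (hgi _)).congr_fun (fun u hu => ?_)
      measurableSet_Ioi
    exact (kernelK_eq_of_pos s (hε.trans hu)).symm
  · have h1 := (tendsto_integral_Ioi_oscKernel_real hα hz)
    have h2 := (Complex.continuous_conj.tendsto _).comp
      (tendsto_integral_Ioi_oscKernel_real hα hz')
    have h3 := ((h1.add h2).div_const 2).comp Real.tendsto_log_nhdsGT_zero
    -- The arc contributions `± I * tilt α` cancel between the two conjugate halves.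
    have h4 : (rayFinitePart α (s - 1) + Complex.I * tilt α +
        conj (rayFinitePart α (conj (s - 1)) + Complex.I * tilt α)) / 2 = entireK α s := by
      rw [entireK]
      simp
      ring
    rw [h4] at h3
    refine h3.congr' ?_
    filter_upwards [self_mem_nhdsWithin,
      Real.tendsto_log_nhdsGT_zero.eventually (eventually_le_atBot 0)] with ε hε hlog
    have h5 : ∫ u in Set.Ioi ε, kernelK α s u = ∫ p in Set.Ioi (Real.log ε), g p := by
      rw [← integral_comp_log_Ioi g hε]
      exact setIntegral_congr_fun measurableSet_Ioi fun u hu =>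
        kernelK_eq_of_pos s (lt_trans hε hu)
    rw [h5, hg, integral_div, integral_add (hi _) (hi'' _), integral_conj]
    simp [hadamardScale, abs_of_nonpos hlog]
    ring

/-- Schwarz reflection: `conj (f (conj z))` is again holomorphic. -/
theorem hasDerivAt_add_conj {f : ℂ → ℂ} {f' : ℂ → ℂ} (hf : ∀ z, HasDerivAt f (f' z) z) (c s : ℂ) :
    HasDerivAt (fun s => c * (f (s - 1) + conj (f (conj (s - 1)))) / 2)
      (c * (f' (s - 1) + conj (f' (conj (s - 1)))) / 2) s := by
  have h1 : HasDerivAt (fun s => f (s - 1)) (f' (s - 1)) s := (hf _).comp_sub_const s 1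
  have h2 : HasDerivAt (fun s => conj (f (conj (s - 1)))) (conj (f' (conj (s - 1)))) s := by
    have := (hf (conj (s - 1))).conj_conj
    rw [Complex.conj_conj] at this
    exact this.comp_sub_const s 1
  exact ((h1.add h2).const_mul c).div_const 2

theorem differentiable_entireK (hα : 1 < α) : Differentiable ℂ (entireK α) := fun s => by
  have h := (hasDerivAt_add_conj (fun z => hasDerivAt_rayFinitePart hα z) 1 s).differentiableAt
  simp only [one_mul] at h
  exact h

theorem iteratedDeriv_entireK (hα : 1 < α) (m : ℕ) :
    iteratedDeriv (m + 1) (entireK α) = fun s => (-1) ^ (m + 1) *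
      (rayMoment α (m + 1) (s - 1) + conj (rayMoment α (m + 1) (conj (s - 1)))) / 2 := by
  induction m with
  | zero =>
    ext s
    rw [iteratedDeriv_one]
    have := (hasDerivAt_add_conj (fun z => hasDerivAt_rayFinitePart hα z) 1 s).deriv
    simp only [one_mul] at this
    refine (this : deriv (entireK α) s = _).trans ?_
    simp
    ring
  | succ m ih =>
    ext s
    rw [iteratedDeriv_succ, ih,
      (hasDerivAt_add_conj (fun z => hasDerivAt_rayMoment hα m.succ_ne_zero z) _ s).deriv]
    simp
    ring

/-- With `w = -i u ^ α` the ray turns to the angle `α * tilt α - π / 2`, and `dw / w = α du / u`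
accounts for the division by `α`. The imaginary part drops out of the mean with the conjugate. -/
theorem rayFinitePart_zero (hα : 1 < α) :
    rayFinitePart α 0 = (-Real.eulerMascheroniConstant -
      Complex.I * (α * tilt α - Real.pi / 2 : ℝ)) / α := by
  have hα0 : 0 < α := by linarith
  have hθ : |α * tilt α - Real.pi / 2| < Real.pi / 2 := by
    have := mul_tilt_lt hα
    have := mul_pos hα0 (tilt_pos hα)
    rw [abs_lt]
    constructor <;> linarith [Real.pi_gt_three]
  have h1 := ((tendsto_integral_Ioi_cexp_neg_cexp_add hθ).comp
    (tendsto_id.const_mul_atBot hα0)).div_const (α : ℂ)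
  refine tendsto_nhds_unique (tendsto_integral_Ioi_rayFinitePart hα 0) (h1.congr fun A => ?_)
  have h2 := integral_comp_mul_left_Ioi (fun p : ℝ => Complex.exp (-Complex.exp (p + Complex.I *
    (α * tilt α - Real.pi / 2 : ℝ)))) A hα0
  have h3 : ∀ p : ℝ, oscKernel α 0 1 0 (p + Complex.I * tilt α) =
      Complex.exp (-Complex.exp ((α * p : ℝ) + Complex.I * (α * tilt α - Real.pi / 2 : ℝ))) := by
    intro p
    have : ((α * p : ℝ) + Complex.I * (α * tilt α - Real.pi / 2 : ℝ) : ℂ) =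
      α * (p + Complex.I * tilt α) - Real.pi / 2 * Complex.I := by push_cast; ring
    rw [this, Complex.exp_sub, Complex.exp_pi_div_two_mul_I, oscKernel, Complex.div_I]
    congr 1
    simp
    ring
  simp only [h3, h2, Function.comp, id]
  have : (α : ℂ) ≠ 0 := by exact_mod_cast hα0.ne'
  rw [Complex.real_smul]
  generalize (∫ p in Set.Ioi (α * A), Complex.exp (-Complex.exp (p + Complex.I *
    (α * tilt α - Real.pi / 2 : ℝ)))) = J
  push_cast
  field_simp

theorem entireK_one (hα : 1 < α) :
    entireK α 1 = ((-Real.eulerMascheroniConstant / α : ℝ) : ℂ) := by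
  rw [entireK, sub_self, map_zero, rayFinitePart_zero hα]
  simp only [map_div₀, map_sub, map_mul, map_neg, Complex.conj_ofReal, Complex.conj_I]
  push_cast
  ring

end Extension

/-! ### The non-stationary half, `z = -i t`. -/

section Rays

variable {α : ℝ}

theorem integral_Ioi_comp_add_right (f : ℝ → ℂ) (A d : ℝ) :
    ∫ p in Set.Ioi A, f (p + d) = ∫ p in Set.Ioi (A + d), f p := by
  have h := (measurePreserving_add_right volume d).setIntegral_preimage_emb
    (measurableEmbedding_addRight d) f (Set.Ioi (A + d))
  simpa using h

theorem integrableOn_Ioi_comp_add_right {f : ℝ → ℂ} {A d : ℝ}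
    (hf : IntegrableOn f (Set.Ioi (A + d))) : IntegrableOn (fun p => f (p + d)) (Set.Ioi A) := by
  have h := (measurePreserving_add_right volume d).integrableOn_comp_preimage
    (measurableEmbedding_addRight d) (f := f) (s := Set.Ioi (A + d))
  simpa [Function.comp_def] using h.2 hf

theorem tendsto_integral_Ioi_cexp_neg_mul_cexp_add {θ T : ℝ} (hθ : |θ| < Real.pi / 2)
    (hT : 0 < T) :
    Tendsto (fun A : ℝ =>
        (∫ p in Set.Ioi A, Complex.exp (-(T * Complex.exp (p + Complex.I * θ)))) + A)
      atBot (𝓝 (-Real.eulerMascheroniConstant - Real.log T - Complex.I * θ)) := by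
  have h := ((tendsto_integral_Ioi_cexp_neg_cexp_add hθ).comp
    (tendsto_atBot_add_const_right _ (Real.log T) tendsto_id)).sub_const (Real.log T : ℂ)
  have e : (-Real.eulerMascheroniConstant - Complex.I * θ - Real.log T : ℂ) =
    -Real.eulerMascheroniConstant - Real.log T - Complex.I * θ := by ring
  rw [e] at h
  refine h.congr fun A => ?_
  simp only [Function.comp, id]
  rw [← integral_Ioi_comp_add_right
    (fun p => Complex.exp (-Complex.exp (p + Complex.I * θ)))]
  have h2 : ∀ p : ℝ, Complex.exp (((p + Real.log T : ℝ) : ℂ) + Complex.I * θ) =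
      T * Complex.exp (p + Complex.I * θ) := fun p => by
    conv_rhs => rw [← Real.exp_log hT, Complex.ofReal_exp, ← Complex.exp_add]
    congr 1
    push_cast
    ring
  simp only [h2]
  push_cast
  ring

theorem integrableOn_cexp_neg_mul_cexp {θ T : ℝ} (hθ : |θ| < Real.pi / 2) (hT : 0 < T) (A : ℝ) :
    IntegrableOn (fun p : ℝ => Complex.exp (-(T * Complex.exp (p + Complex.I * θ))))
      (Set.Ioi A) := by
  refine (integrableOn_Ioi_comp_add_right (d := Real.log T)
    (integrableOn_exp_neg_exp_Ioi hθ (A + Real.log T))).congr_fun (fun p _ => ?_) measurableSet_Ioi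
  simp only
  conv_rhs => rw [← Real.exp_log hT, Complex.ofReal_exp, ← Complex.exp_add]
  congr 3
  push_cast
  ring

/-- Mean value inequality on a half plane. Depending on `w.re` rather than `‖w‖` in the exponential,
it loses nothing when `w` is large with negative real part. -/
theorem Complex.norm_exp_sub_one_le_mul_max (w : ℂ) :
    ‖Complex.exp w - 1‖ ≤ ‖w‖ * max 1 (Real.exp w.re) := by
  have h := (convex_halfSpace_re_le (max 0 w.re)).norm_image_sub_le_of_norm_hasDerivWithin_le
    (f := Complex.exp) (f' := Complex.exp) (C := max 1 (Real.exp w.re)) (x := 0) (y := w)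
    (fun x _ => (Complex.hasDerivAt_exp x).hasDerivWithinAt) (fun x hx => ?_) (by simp) (by simp)
  · simpa [mul_comm] using h
  · rw [Complex.norm_exp]
    rcases le_max_iff.1 (show x.re ≤ max 0 w.re from hx) with h | h
    · exact le_max_of_le_left (Real.exp_le_one_iff.2 h)
    · exact le_max_of_le_right (Real.exp_le_exp.2 h)

theorem norm_oscKernel_neg_ray (m : ℕ) (t p : ℝ) :
    ‖oscKernel α m 1 (-(Complex.I * t)) (p + Complex.I * tilt α)‖ =
      Real.exp (m * p - Real.sin (α * tilt α) * Real.exp (α * p) -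
        Real.sin (tilt α) * t * Real.exp p) := by
  rw [norm_oscKernel]
  simp
  ring

theorem exists_norm_rayMoment_neg_le (hα : 1 < α) {m : ℕ} (hm : m ≠ 0) :
    ∃ C, ∀ t : ℝ, 0 < t → ‖rayMoment α m (-(Complex.I * t))‖ ≤ C * t ^ (-(m : ℝ)) := by
  refine ⟨∫ p : ℝ, Real.exp (m * p - Real.sin (tilt α) * Real.exp p), fun t ht => ?_⟩
  rw [mul_comm (∫ p : ℝ, _), ← integral_exp_mul_sub_mul_exp _ _ ht]
  refine norm_integral_le_of_norm_le (integrable_exp_mul_sub_exp (by positivity)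
    (mul_pos (sin_tilt_pos hα) ht)) (Eventually.of_forall fun p => ?_)
  rw [norm_oscKernel_neg_ray, Real.exp_le_exp]
  have := mul_pos (sin_mul_tilt_pos hα) (Real.exp_pos (α * p))
  linarith

/-- Compare with `exp (i t u)` alone: on the ray `exp (i u ^ α) - 1` is at most `|u| ^ α`, and `∫ u
^ α exp (-c t u) du / u` scales as `t ^ (-α)`. -/
theorem exists_norm_rayFinitePart_neg_sub_le (hα : 1 < α) :
    ∃ C, ∀ t : ℝ, 0 < t → ‖rayFinitePart α (-(Complex.I * t)) -
      (-Real.eulerMascheroniConstant - Real.log t -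
        Complex.I * (tilt α - Real.pi / 2 : ℝ))‖ ≤ C * t ^ (-α) := by
  refine ⟨∫ p : ℝ, Real.exp (α * p - Real.sin (tilt α) * Real.exp p), fun t ht => ?_⟩
  have hα0 : 0 < α := by linarith
  have hθ : |tilt α - Real.pi / 2| < Real.pi / 2 := by
    have := tilt_lt hα
    have := tilt_pos hα
    rw [abs_lt]
    constructor <;> linarith [Real.pi_gt_three]
  have hint := integrable_exp_mul_sub_exp hα0 (mul_pos (sin_tilt_pos hα) ht)
  rw [mul_comm (∫ p : ℝ, _), ← integral_exp_mul_sub_mul_exp _ _ ht]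
  refine le_of_tendsto ((tendsto_integral_Ioi_rayFinitePart hα _).sub
    (tendsto_integral_Ioi_cexp_neg_mul_cexp_add hθ ht)).norm (Eventually.of_forall fun A => ?_)
  rw [add_sub_add_right_eq_sub, ← integral_sub
    (integrableOn_oscKernel_Ioi hα 0 _ (sin_mul_tilt_pos hα) A)
    (integrableOn_cexp_neg_mul_cexp hθ ht A)]
  refine (norm_integral_le_of_norm_le hint.integrableOn (Eventually.of_forall fun p => ?_)).trans
    (setIntegral_le_integral hint (Eventually.of_forall fun p => (Real.exp_pos _).le))
  have h1 : Complex.exp (p + Complex.I * (tilt α - Real.pi / 2 : ℝ)) =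
      -(Complex.I * Complex.exp (p + Complex.I * tilt α)) := by
    rw [show (p + Complex.I * (tilt α - Real.pi / 2 : ℝ) : ℂ) =
      (p + Complex.I * tilt α) - Real.pi / 2 * Complex.I by push_cast; ring, Complex.exp_sub,
      Complex.exp_pi_div_two_mul_I, Complex.div_I]
    ring
  set w := Complex.I * Complex.exp (α * (p + Complex.I * tilt α)) with hw
  set a := Complex.I * t * Complex.exp (p + Complex.I * tilt α) with ha
  have h2 : oscKernel α 0 1 (-(Complex.I * t)) (p + Complex.I * tilt α) =
      Complex.exp a * Complex.exp w := by
    rw [← Complex.exp_add, oscKernel, ha, hw]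
    congr 1
    simp
    ring
  have h3 : Complex.exp (-(t * Complex.exp (p + Complex.I * (tilt α - Real.pi / 2 : ℝ)))) =
      Complex.exp a := by
    rw [h1, ha]
    congr 1
    ring
  have h4 : w.re = -(Real.sin (α * tilt α) * Real.exp (α * p)) := by
    simp [hw, Complex.exp_im]
    ring
  have h5 : a.re = -(Real.sin (tilt α) * t * Real.exp p) := by
    simp [ha, Complex.exp_im, Complex.exp_re]
    ring
  have h6 : ‖w‖ = Real.exp (α * p) := by
    simp [hw, Complex.norm_exp]
  rw [h2, h3, ← mul_sub_one, norm_mul, Complex.norm_exp, h5]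
  have h7 := Complex.norm_exp_sub_one_le_mul_max w
  rw [max_eq_left, mul_one, h6] at h7
  · calc _ ≤ Real.exp (-(Real.sin (tilt α) * t * Real.exp p)) * Real.exp (α * p) := by gcongr
      _ = _ := by rw [← Real.exp_add]; ring_nf
  · rw [Real.exp_le_one_iff, h4]
    have := mul_pos (sin_mul_tilt_pos hα) (Real.exp_pos (α * p))
    linarith

end Rays

/-! ### The contour through the saddle point. -/

section Deformation

variable {α : ℝ}

theorem sq_mul_tilt (hα : 1 < α) : α ^ 2 * tilt α = (α - 1) / 4 := by
  rw [tilt]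
  field_simp

/-- Positivity of the decay rate where the outgoing leg begins, at `p = tilt α`. With `d = tilt α`
one has `(α d) ^ 2 = (α - 1) d / 4`, so the cubic loss in the sine is smaller than the gain `1 + (α
- 1) d` from the exponential. This dictates the choice of `tilt`. -/
theorem mul_sin_tilt_lt (hα : 1 < α) :
    α * Real.sin (tilt α) < Real.exp ((α - 1) * tilt α) * Real.sin (α * tilt α) := by
  have hd := tilt_pos hα
  have hy := mul_tilt_lt hα
  have hy0 : 0 < α * tilt α := mul_pos (by linarith) hd
  have h1 := Real.sin_gt_sub_cube hy0
  have h2 := Real.add_one_le_exp ((α - 1) * tilt α)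
  have h3 : α * Real.sin (tilt α) < α * tilt α :=
    mul_lt_mul_of_pos_left (Real.sin_lt hd) (by linarith)
  have h4 : (α * tilt α) ^ 2 = (α - 1) * tilt α / 4 := by
    linear_combination tilt α * sq_mul_tilt hα
  have hu : 0 < (α - 1) * tilt α := mul_pos (by linarith) hd
  have h5 : α * tilt α < ((α - 1) * tilt α + 1) * (α * tilt α - (α * tilt α) ^ 3 / 6) := by
    have : ((α - 1) * tilt α + 1) * (α * tilt α - (α * tilt α) ^ 3 / 6) - α * tilt α =
      α * tilt α * ((α - 1) * tilt α * (1 - (α * tilt α) ^ 2 / 6) - (α * tilt α) ^ 2 / 6) := by ring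
    have h6 : 0 < (α - 1) * tilt α * (1 - (α * tilt α) ^ 2 / 6) - (α * tilt α) ^ 2 / 6 := by
      nlinarith
    nlinarith [mul_pos hy0 h6]
  have h7 : 0 < α * tilt α - (α * tilt α) ^ 3 / 6 := by nlinarith
  calc _ < α * tilt α := h3
    _ < _ := h5
    _ ≤ Real.exp ((α - 1) * tilt α) * (α * tilt α - (α * tilt α) ^ 3 / 6) := by gcongr
    _ ≤ _ := by gcongr

/-- The mirror condition at the end `p = -tilt α` of the incoming leg, where `exp (-z u)` must beat
the growth of `exp (i u ^ α)` below the real axis. -/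
theorem lt_mul_sin_tilt (hα : 1 < α) :
    Real.exp (-((α - 1) * tilt α)) * Real.sin (α * tilt α) < α * Real.sin (tilt α) := by
  have hd := tilt_pos hα
  have hd1 := tilt_lt hα
  have hy0 : 0 < α * tilt α := mul_pos (by linarith) hd
  have h1 := Real.sin_gt_sub_cube hd
  have h2 := Real.add_one_le_exp ((α - 1) * tilt α)
  have hu : 0 < (α - 1) * tilt α := mul_pos (by linarith) hd
  have h4 : (α * tilt α) ^ 2 = (α - 1) * tilt α / 4 := by
    linear_combination tilt α * sq_mul_tilt hα
  have h5 : tilt α ^ 2 ≤ (α * tilt α) ^ 2 := by nlinarith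
  have h3 : α * tilt α < ((α - 1) * tilt α + 1) * (α * (tilt α - tilt α ^ 3 / 6)) := by
    have : ((α - 1) * tilt α + 1) * (α * (tilt α - tilt α ^ 3 / 6)) - α * tilt α =
      α * tilt α * ((α - 1) * tilt α * (1 - tilt α ^ 2 / 6) - tilt α ^ 2 / 6) := by ring
    have h6 : 0 < (α - 1) * tilt α * (1 - tilt α ^ 2 / 6) - tilt α ^ 2 / 6 := by nlinarith
    nlinarith [mul_pos hy0 h6]
  rw [Real.exp_neg, inv_mul_lt_iff₀ (Real.exp_pos _)]
  have h7 : 0 < tilt α - tilt α ^ 3 / 6 := by nlinarith [sq_nonneg (tilt α)]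
  have h8 : 0 < α * (tilt α - tilt α ^ 3 / 6) := mul_pos (by linarith) h7
  calc _ ≤ α * tilt α := Real.sin_le hy0.le
    _ < _ := h3
    _ ≤ Real.exp ((α - 1) * tilt α) * (α * (tilt α - tilt α ^ 3 / 6)) := by gcongr
    _ ≤ _ := by gcongr

/-- The decay rate of the rescaled kernel on the part of the contour before the saddle point. -/
noncomputable def leftRate (α : ℝ) : ℝ :=
  α * Real.sin (tilt α) - Real.exp (-((α - 1) * tilt α)) * Real.sin (α * tilt α)

/-- The decay rate of the rescaled kernel on the part of the contour after the saddle point. -/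
noncomputable def rightRate (α : ℝ) : ℝ :=
  Real.exp ((α - 1) * tilt α) * Real.sin (α * tilt α) - α * Real.sin (tilt α)

theorem leftRate_pos (hα : 1 < α) : 0 < leftRate α := sub_pos.2 (lt_mul_sin_tilt hα)

theorem rightRate_pos (hα : 1 < α) : 0 < rightRate α := sub_pos.2 (mul_sin_tilt_lt hα)

theorem norm_oscKernel_saddle (m : ℕ) (l p y : ℝ) :
    ‖oscKernel α m l (Complex.I * (α * l : ℝ)) (p + Complex.I * y)‖ =
      Real.exp (m * p - l * (Real.sin (α * y) * Real.exp (α * p) -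
        α * Real.sin y * Real.exp p)) := by
  rw [norm_oscKernel]
  congr 1
  simp
  ring

theorem norm_oscKernel_left_le (hα : 1 < α) (m : ℕ) {l : ℝ} (hl : 0 < l) {p : ℝ}
    (hp : p ≤ -tilt α) :
    ‖oscKernel α m l (Complex.I * (α * l : ℝ)) (p + Complex.I * (-tilt α : ℝ))‖ ≤
      Real.exp (m * p - leftRate α * l * Real.exp p) := by
  rw [norm_oscKernel_saddle, Real.exp_le_exp, mul_neg, Real.sin_neg, Real.sin_neg, leftRate]
  have h1 : Real.exp (α * p) ≤ Real.exp (-((α - 1) * tilt α)) * Real.exp p := by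
    rw [← Real.exp_add, Real.exp_le_exp]
    nlinarith
  have h2 := mul_le_mul_of_nonneg_left h1 (mul_pos hl (sin_mul_tilt_pos hα)).le
  linarith

theorem norm_oscKernel_right_le (hα : 1 < α) (m : ℕ) {l : ℝ} (hl : 0 < l) {p : ℝ}
    (hp : tilt α ≤ p) :
    ‖oscKernel α m l (Complex.I * (α * l : ℝ)) (p + Complex.I * tilt α)‖ ≤
      Real.exp (m * p - rightRate α * l * Real.exp p) := by
  rw [norm_oscKernel_saddle, Real.exp_le_exp, rightRate]
  have h1 : Real.exp ((α - 1) * tilt α) * Real.exp p ≤ Real.exp (α * p) := by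
    rw [← Real.exp_add, Real.exp_le_exp]
    nlinarith
  have h2 := mul_le_mul_of_nonneg_left h1 (mul_pos hl (sin_mul_tilt_pos hα)).le
  linarith

/-- The integral of the rescaled kernel along the part of the contour that passes through the
saddle point and then goes to infinity. -/
noncomputable def saddleArc (α : ℝ) (m : ℕ) (l : ℝ) : ℂ :=
  (∫ p in -tilt α..tilt α, oscKernel α m l (Complex.I * (α * l : ℝ)) (p * (1 + Complex.I)) *
    (1 + Complex.I)) +
  ∫ p in Set.Ioi (tilt α), oscKernel α m l (Complex.I * (α * l : ℝ)) (p + Complex.I * tilt α)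

theorem integrableOn_oscKernel_right (hα : 1 < α) (m : ℕ) {l : ℝ} (hl : 0 < l) (A : ℝ) :
    IntegrableOn (fun p : ℝ => oscKernel α m l (Complex.I * (α * l : ℝ))
      (p + Complex.I * tilt α)) (Set.Ioi A) := by
  have h : IntegrableOn (fun p : ℝ => oscKernel α m l (Complex.I * (α * l : ℝ))
      (p + Complex.I * tilt α)) (Set.Ioi (tilt α)) := by
    refine (integrableOn_exp_mul_sub_exp_Ioi (s := m) m.cast_nonneg
      (mul_pos (rightRate_pos hα) hl) _).mono' (by fun_prop) ?_
    filter_upwards [ae_restrict_mem measurableSet_Ioi] with p hp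
    exact norm_oscKernel_right_le hα m hl (le_of_lt hp)
  have h2 : IntegrableOn (fun p : ℝ => oscKernel α m l (Complex.I * (α * l : ℝ))
      (p + Complex.I * tilt α)) (Set.Ioc A (tilt α)) :=
    (Continuous.integrableOn_Icc (by fun_prop)).mono_set Set.Ioc_subset_Icc_self
  refine (h2.union h).mono_set fun p hp => ?_
  rcases le_or_gt p (tilt α) with h3 | h3
  · exact Or.inl ⟨hp, h3⟩
  · exact Or.inr h3

/-- The path descends at real part `A` to height `-tilt α`, follows that height, crosses `0` with
slope one and continues at height `tilt α`; all pieces are read off one primitive. -/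
theorem integral_Ioi_eq_add_saddleArc (hα : 1 < α) (m : ℕ) {l : ℝ} (hl : 0 < l) (A : ℝ) :
    ∫ p in Set.Ioi A, oscKernel α m l (Complex.I * (α * l : ℝ)) (p + Complex.I * tilt α) =
      (∫ p in A..-tilt α, oscKernel α m l (Complex.I * (α * l : ℝ))
        (p + Complex.I * (-tilt α : ℝ))) + saddleArc α m l -
      Complex.I * ∫ y in -tilt α..tilt α,
        oscKernel α m l (Complex.I * (α * l : ℝ)) (A + Complex.I * y) := by
  have hc := continuous_oscKernel (α := α) m l (Complex.I * (α * l : ℝ))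
  obtain ⟨P, hP⟩ := (differentiable_oscKernel (α := α) m l
    (Complex.I * (α * l : ℝ))).isExactOn_univ
  have hP' : ∀ z, HasDerivAt P _ z := fun z => hP z trivial
  have h1 := HasDerivAt.intervalIntegral_line hc hP' (Complex.I * (-tilt α : ℝ)) 1 A (-tilt α)
  have h2 := HasDerivAt.intervalIntegral_line hc hP' 0 (1 + Complex.I) (-tilt α) (tilt α)
  have h3 := HasDerivAt.intervalIntegral_line hc hP' A Complex.I (-tilt α) (tilt α)
  have h4 := HasDerivAt.intervalIntegral_line hc hP' (Complex.I * (tilt α : ℝ)) 1 A (tilt α)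
  have h5 := intervalIntegral.integral_interval_add_Ioi
    (integrableOn_oscKernel_right hα m hl A) (integrableOn_oscKernel_right hα m hl (tilt α))
  rw [intervalIntegral.integral_mul_const] at h3
  simp only [mul_one, zero_add, add_comm (Complex.I * _), mul_comm _ Complex.I] at h1 h2 h3 h4
  rw [saddleArc, ← h5]
  simp only [mul_comm _ (1 + Complex.I), mul_comm Complex.I (∫ y in _.._, _)] at h2 h3 ⊢
  rw [h1, h2, h4]
  rw [h3]
  have e1 : (1 + Complex.I) * (tilt α : ℝ) = (tilt α : ℂ) + Complex.I * (tilt α : ℝ) := by ring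
  have e2 : (1 + Complex.I) * (-tilt α : ℝ) = ((-tilt α : ℝ) : ℂ) + Complex.I * (-tilt α : ℝ) := by
    ring
  rw [e1, e2]
  ring

/-- For `z = i α u ^ (α - 1)` the stationary point is `u`; translating by `log u` puts it at `x = 0`
and leaves the single large parameter `u ^ α`. -/
theorem oscKernel_add_log (m : ℕ) {u : ℝ} (hu : 0 < u) (x : ℂ) :
    oscKernel α m 1 (Complex.I * (α * u ^ (α - 1) : ℝ)) (x + Real.log u) =
      (u ^ m : ℝ) * oscKernel α m (u ^ α) (Complex.I * (α * u ^ α : ℝ)) x := by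
  have h1 : (u ^ m : ℝ) = Real.exp (m * Real.log u) := by
    rw [mul_comm, Real.exp_mul, Real.exp_log hu, Real.rpow_natCast]
  have h2 : Complex.exp (α * (x + Real.log u)) = (u ^ α : ℝ) * Complex.exp (α * x) := by
    rw [Real.rpow_def_of_pos hu, Complex.ofReal_exp, ← Complex.exp_add]
    congr 1
    push_cast
    ring
  have h3 : Complex.exp (x + Real.log u) = u * Complex.exp x := by
    rw [Complex.exp_add, ← Complex.ofReal_exp, Real.exp_log hu, mul_comm]
  have h4 : (u ^ α : ℝ) = u ^ (α - 1) * u := by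
    rw [← Real.rpow_add_one hu.ne']
    ring_nf
  rw [oscKernel, h2, h3, oscKernel, h1, Complex.ofReal_exp, ← Complex.exp_add, h4]
  congr 1
  push_cast
  ring

theorem integral_Ioi_oscKernel_eq_rescaled (m : ℕ) {u : ℝ} (hu : 0 < u) (A : ℝ) :
    ∫ p in Set.Ioi (A + Real.log u), oscKernel α m 1 (Complex.I * (α * u ^ (α - 1) : ℝ))
      (p + Complex.I * tilt α) =
    (u ^ m : ℝ) * ∫ p in Set.Ioi A, oscKernel α m (u ^ α) (Complex.I * (α * u ^ α : ℝ))
      (p + Complex.I * tilt α) := by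
  rw [← integral_Ioi_comp_add_right (fun p : ℝ => oscKernel α m 1
    (Complex.I * (α * u ^ (α - 1) : ℝ)) (p + Complex.I * tilt α)), ← integral_const_mul]
  congr 1 with p
  rw [← oscKernel_add_log m hu]
  congr 1
  push_cast
  ring

/-- The incoming leg is the whole error, as the vertical side vanishes like `exp (m A)` when `m >
0`. -/
theorem exists_norm_rayMoment_sub_saddleArc_le (hα : 1 < α) {m : ℕ} (hm : m ≠ 0) :
    ∃ C, ∀ u : ℝ, 0 < u → ‖rayMoment α m (Complex.I * (α * u ^ (α - 1) : ℝ)) -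
      (u ^ m : ℝ) * saddleArc α m (u ^ α)‖ ≤ u ^ m * (C * (u ^ α) ^ (-(m : ℝ))) := by
  refine ⟨∫ p : ℝ, Real.exp (m * p - leftRate α * Real.exp p), fun u hu => ?_⟩
  have hl : 0 < u ^ α := Real.rpow_pos_of_pos hu α
  have hm' : 0 < (m : ℝ) := by positivity
  have hint := integrable_exp_mul_sub_exp hm' (mul_pos (leftRate_pos hα) hl)
  rw [mul_comm (∫ p : ℝ, _), ← integral_exp_mul_sub_mul_exp _ _ hl]
  have h1 := (tendsto_integral_Ioi_rayMoment hα hm (Complex.I * (α * u ^ (α - 1) : ℝ))).comp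
    (tendsto_atBot_add_const_right _ (Real.log u) tendsto_id)
  have hvert := tendsto_integral_vertical (a := -tilt α) (b := tilt α) (c := 0)
    (continuous_oscKernel (α := α) m (u ^ α) (Complex.I * (α * u ^ α : ℝ)))
    (g := fun p => Real.exp (m * p + (u ^ α * Real.exp (α * p) +
      ‖Complex.I * (α * u ^ α : ℝ)‖ * Real.exp p)))
    (by
      refine Real.tendsto_exp_atBot.comp ((tendsto_id.const_mul_atBot hm').atBot_add
        (C := u ^ α * 0 + ‖Complex.I * (α * u ^ α : ℝ)‖ * 0) ?_)
      exact ((Real.tendsto_exp_atBot.comp (tendsto_id.const_mul_atBot (by linarith))).const_mul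
        _).add (Real.tendsto_exp_atBot.const_mul _))
    (Eventually.of_forall fun p y _ => by
      rw [sub_zero, norm_oscKernel, Real.exp_le_exp]
      have h2 := neg_le_of_abs_le
        (abs_re_mul_cos_sub_im_mul_sin_le (Complex.I * (α * u ^ α : ℝ)) y)
      have h3 := mul_le_mul_of_nonneg_right h2 (Real.exp_pos p).le
      have h4 := mul_le_mul_of_nonneg_left (Real.neg_one_le_sin (α * y))
        (mul_pos hl (Real.exp_pos (α * p))).le
      linarith)
  have h2 := (h1.sub_const ((u ^ m : ℝ) * saddleArc α m (u ^ α))).add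
    (hvert.const_mul ((u ^ m : ℝ) * Complex.I))
  rw [mul_zero, mul_zero, add_zero] at h2
  refine le_of_tendsto h2.norm ?_
  filter_upwards [eventually_le_atBot (-tilt α)] with A hA
  simp only [Function.comp, id, integral_Ioi_oscKernel_eq_rescaled m hu,
    integral_Ioi_eq_add_saddleArc hα m hl]
  rw [show ∀ a b c d : ℂ, a * (b + c - Complex.I * d) - a * c + a * Complex.I * d = a * b by
    intros; ring, norm_mul, Complex.norm_real, Real.norm_of_nonneg (by positivity)]
  gcongr
  rw [intervalIntegral.integral_of_le hA]
  refine (norm_integral_le_of_norm_le hint.integrableOn ?_).trans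
    (setIntegral_le_integral hint (Eventually.of_forall fun p => (Real.exp_pos _).le))
  filter_upwards [ae_restrict_mem measurableSet_Ioc] with p hp
  exact norm_oscKernel_left_le hα m hl hp.2

end Deformation

/-! ### The same deformation for the finite part. -/

section FinitePartDeformation

variable {α : ℝ}

theorem abs_pi_div_two_sub_tilt_lt (hα : 1 < α) : |Real.pi / 2 - tilt α| < Real.pi / 2 := by
  have := tilt_lt hα
  have := tilt_pos hα
  rw [abs_lt]
  constructor <;> linarith [Real.pi_gt_three]

/-- Below the real axis `exp w` grows, so the bound carries `exp w.re`; its product with `exp a` is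
the full kernel, whose decay on this leg is already known. -/
theorem norm_oscKernel_zero_left_sub_le (hα : 1 < α) {l : ℝ} (hl : 0 < l) {p : ℝ}
    (hp : p ≤ -tilt α) :
    ‖oscKernel α 0 l (Complex.I * (α * l : ℝ)) (p + Complex.I * (-tilt α : ℝ)) -
      Complex.exp (-((α * l : ℝ) * Complex.exp (p + Complex.I * (Real.pi / 2 - tilt α : ℝ))))‖ ≤
      l * Real.exp (α * p - leftRate α * l * Real.exp p) := by
  have h1 : Complex.exp (p + Complex.I * (Real.pi / 2 - tilt α : ℝ)) =
      Complex.I * Complex.exp (p + Complex.I * (-tilt α : ℝ)) := by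
    rw [show (p + Complex.I * (Real.pi / 2 - tilt α : ℝ) : ℂ) =
      (p + Complex.I * (-tilt α : ℝ)) + Real.pi / 2 * Complex.I by push_cast; ring, Complex.exp_add,
      Complex.exp_pi_div_two_mul_I, mul_comm]
  set w := Complex.I * l * Complex.exp (α * (p + Complex.I * (-tilt α : ℝ))) with hw
  set a := -((α * l : ℝ) * Complex.exp (p + Complex.I * (Real.pi / 2 - tilt α : ℝ))) with ha
  have h2 : oscKernel α 0 l (Complex.I * (α * l : ℝ)) (p + Complex.I * (-tilt α : ℝ)) =
      Complex.exp a * Complex.exp w := by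
    rw [← Complex.exp_add, oscKernel, ha, hw, h1]
    congr 1
    simp
    ring
  have h4 : w.re = l * (Real.sin (α * tilt α) * Real.exp (α * p)) := by
    simp [hw, Complex.exp_im]
    left
    ring
  have h6 : ‖w‖ = l * Real.exp (α * p) := by
    simp [hw, Complex.norm_exp, abs_of_pos hl]
  have h7 := Complex.norm_exp_sub_one_le_mul_max w
  rw [max_eq_right, h6] at h7
  · have h8 := norm_oscKernel_left_le hα 0 hl hp
    rw [h2, norm_mul, Complex.norm_exp w] at h8
    rw [h2, ← mul_sub_one, norm_mul]
    calc _ ≤ ‖Complex.exp a‖ * (l * Real.exp (α * p) * Real.exp w.re) := by gcongr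
      _ = (‖Complex.exp a‖ * Real.exp w.re) * (l * Real.exp (α * p)) := by ring
      _ ≤ Real.exp ((0 : ℕ) * p - leftRate α * l * Real.exp p) * (l * Real.exp (α * p)) := by
        gcongr
      _ = l * (Real.exp ((0 : ℕ) * p - leftRate α * l * Real.exp p) * Real.exp (α * p)) := by ring
      _ = _ := by rw [← Real.exp_add]; simp; left; ring_nf
  · rw [Real.one_le_exp_iff, h4]
    have := sin_mul_tilt_pos hα
    positivity

theorem exists_norm_integral_Ioi_cexp_neg_mul_cexp_le {θ : ℝ} (hθ : |θ| < Real.pi / 2) (B : ℝ) :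
    ∃ C, ∀ T : ℝ, 0 < T →
      ‖∫ p in Set.Ioi B, Complex.exp (-(T * Complex.exp (p + Complex.I * θ)))‖ ≤ C * T⁻¹ := by
  have hc : 0 < Real.cos θ := Real.cos_pos_of_mem_Ioo (abs_lt.1 hθ)
  refine ⟨∫ p in Set.Ioi B, (Real.cos θ)⁻¹ * Real.exp (-1 * p), fun T hT => ?_⟩
  rw [← integral_mul_const]
  refine norm_integral_le_of_norm_le (((integrableOn_exp_mul_Ioi (by norm_num) B).const_mul
    _).mul_const _) (Eventually.of_forall fun p => ?_)
  have h1 : (-(T * Complex.exp (p + Complex.I * θ))).re = -(T * Real.cos θ * Real.exp p) := by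
    simp [Complex.exp_re]
    ring
  have hx : 0 < T * Real.cos θ * Real.exp p := by positivity
  rw [Complex.norm_exp, h1, Real.exp_neg]
  calc _ ≤ (T * Real.cos θ * Real.exp p)⁻¹ := by
        gcongr
        linarith [Real.add_one_le_exp (T * Real.cos θ * Real.exp p)]
    _ = _ := by
      rw [neg_one_mul, Real.exp_neg]
      field_simp

/-- On the incoming leg the kernel is compared with `exp (-z u)` alone, at a cost of `l ^ (1 - α)`.
Extending that exponential past `-tilt α` to a full regularised integral costs `l⁻¹`. -/
theorem exists_norm_rayFinitePart_sub_saddleArc_le (hα : 1 < α) :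
    ∃ C, ∀ u : ℝ, 0 < u → ‖rayFinitePart α (Complex.I * (α * u ^ (α - 1) : ℝ)) -
      (-Real.eulerMascheroniConstant - Real.log (α * u ^ (α - 1)) -
        Complex.I * (Real.pi / 2 + tilt α : ℝ)) - saddleArc α 0 (u ^ α)‖ ≤
      C * (u ^ α)⁻¹ + C * (u ^ α) ^ (1 - α) := by
  have hα0 : 0 < α := by linarith
  have hθ := abs_pi_div_two_sub_tilt_lt hα
  obtain ⟨C, hC⟩ := exists_norm_integral_Ioi_cexp_neg_mul_cexp_le hθ (-tilt α)
  set D := ∫ p : ℝ, Real.exp (α * p - leftRate α * Real.exp p) with hD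
  have hC0 : 0 ≤ C := by simpa using (norm_nonneg _).trans (hC 1 one_pos)
  have hD0 : 0 ≤ D := integral_nonneg fun p => (Real.exp_pos _).le
  refine ⟨C + D, fun u hu => ?_⟩
  have hl : 0 < u ^ α := Real.rpow_pos_of_pos hu α
  have hT : 0 < α * u ^ α := mul_pos hα0 hl
  have hint := integrable_exp_mul_sub_exp hα0 (mul_pos (leftRate_pos hα) hl)
  set E : ℝ → ℂ := fun p => Complex.exp (-((α * u ^ α : ℝ) *
    Complex.exp (p + Complex.I * (Real.pi / 2 - tilt α : ℝ)))) with hE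
  have h1 := (tendsto_integral_Ioi_rayFinitePart hα (Complex.I * (α * u ^ (α - 1) : ℝ))).comp
    (tendsto_atBot_add_const_right _ (Real.log u) tendsto_id)
  have h2 := tendsto_integral_Ioi_cexp_neg_mul_cexp_add hθ hT
  have hvert := tendsto_integral_vertical (a := -tilt α) (b := tilt α) (c := 1)
    (continuous_oscKernel (α := α) 0 (u ^ α) (Complex.I * (α * u ^ α : ℝ)))
    (by simpa using Real.tendsto_exp_atBot.const_mul ((|u ^ α| + ‖Complex.I * (α * u ^ α : ℝ)‖) *
      Real.exp (|u ^ α| + ‖Complex.I * (α * u ^ α : ℝ)‖)))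
    (by
      filter_upwards [eventually_le_atBot 0] with p hp y _
      simpa using norm_oscKernel_zero_sub_one_le hα (u ^ α) (Complex.I * (α * u ^ α : ℝ)) hp y)
  have h3 := (((h1.sub h2).sub_const (Real.log u + saddleArc α 0 (u ^ α))).add
    (hvert.const_mul Complex.I))
  have hlog : Real.log (α * u ^ α) = Real.log (α * u ^ (α - 1)) + Real.log u := by
    rw [← Real.log_mul (by positivity) hu.ne', mul_assoc, ← Real.rpow_add_one hu.ne']
    ring_nf
  -- The angle `π / 2 - tilt α` of the comparison ray and the arc of opening `2 * tilt α` add up to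
  -- `π / 2 + tilt α`; the shift `log u` turns `log (α l)` into `log (α u ^ (α - 1))`.
  have hlim : ∀ R S : ℂ, R - (-Real.eulerMascheroniConstant - Real.log (α * u ^ α) -
      Complex.I * (Real.pi / 2 - tilt α : ℝ)) - (Real.log u + S) +
      Complex.I * ((tilt α - (-tilt α : ℝ)) * 1) = R - (-Real.eulerMascheroniConstant -
      Real.log (α * u ^ (α - 1)) - Complex.I * (Real.pi / 2 + tilt α : ℝ)) - S := by
    intro R S
    rw [hlog]
    push_cast
    ring
  rw [hlim] at h3
  refine le_of_tendsto h3.norm ?_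
  filter_upwards [eventually_le_atBot (-tilt α)] with A hA
  have h5 := intervalIntegral.integral_interval_add_Ioi
    (integrableOn_cexp_neg_mul_cexp hθ hT A) (integrableOn_cexp_neg_mul_cexp hθ hT (-tilt α))
  have h6 := integral_Ioi_oscKernel_eq_rescaled (α := α) 0 hu A
  rw [integral_Ioi_eq_add_saddleArc hα 0 hl] at h6
  have h7 : ‖(∫ p in A..-tilt α, oscKernel α 0 (u ^ α) (Complex.I * (α * u ^ α : ℝ))
      (p + Complex.I * (-tilt α : ℝ))) - ∫ p in A..-tilt α, E p‖ ≤ D * (u ^ α) ^ (1 - α) := by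
    rw [← intervalIntegral.integral_sub (Continuous.intervalIntegrable (by fun_prop) _ _)
      (Continuous.intervalIntegrable (by fun_prop) _ _), intervalIntegral.integral_of_le hA]
    have h8 : D * (u ^ α) ^ (1 - α) =
        ∫ p : ℝ, u ^ α * Real.exp (α * p - leftRate α * u ^ α * Real.exp p) := by
      rw [integral_const_mul, integral_exp_mul_sub_mul_exp _ _ hl, sub_eq_add_neg,
        Real.rpow_add hl, Real.rpow_one]
      ring
    rw [h8]
    refine (norm_integral_le_of_norm_le (hint.const_mul (u ^ α)).integrableOn ?_).trans
      (setIntegral_le_integral (hint.const_mul (u ^ α)) (Eventually.of_forall fun p =>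
        (mul_pos hl (Real.exp_pos _)).le))
    filter_upwards [ae_restrict_mem measurableSet_Ioc] with p hp
    exact norm_oscKernel_zero_left_sub_le hα hl hp.2
  have h9 := hC _ hT
  have h10 : C * (α * u ^ α)⁻¹ ≤ C * (u ^ α)⁻¹ := by
    gcongr
    nlinarith
  have h11 : 0 ≤ (u ^ α) ^ (1 - α) := (Real.rpow_pos_of_pos hl _).le
  have h12 : 0 ≤ (u ^ α)⁻¹ := (inv_pos.2 hl).le
  simp only [Function.comp, id]
  rw [h6, ← h5]
  refine le_trans (le_of_eq ?_) ((norm_sub_le _ _).trans (add_le_add h7 (h9.trans h10)) |>.trans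
    (by nlinarith [mul_nonneg hC0 h11, mul_nonneg hD0 h12]))
  congr 1
  simp only [hE, Complex.ofReal_add, pow_zero, Complex.ofReal_one]
  ring

end FinitePartDeformation

/-! ### Local expansion at the saddle point. -/

section Saddle

variable {α : ℝ}

theorem norm_cexp_sub_cubic_le {y : ℂ} (hy : ‖y‖ ≤ 1) :
    ‖Complex.exp y - (1 + y + y ^ 2 / 2 + y ^ 3 / 6)‖ ≤ ‖y‖ ^ 4 := by
  have h := Complex.exp_bound hy (n := 4) (by norm_num)
  simp only [Finset.sum_range_succ, Finset.sum_range_zero, Nat.factorial] at h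
  norm_num at h
  have h2 : 0 ≤ ‖y‖ ^ 4 := by positivity
  linarith

theorem norm_cexp_sub_quadratic_le {y : ℂ} (hy : ‖y‖ ≤ 1) :
    ‖Complex.exp y - (1 + y + y ^ 2 / 2)‖ ≤ 2 / 9 * ‖y‖ ^ 3 := by
  have h := Complex.exp_bound hy (n := 3) (by norm_num)
  simp only [Finset.sum_range_succ, Finset.sum_range_zero, Nat.factorial] at h
  norm_num at h
  linarith

theorem norm_cexp_sub_one_sub_self_le (w : ℂ) :
    ‖Complex.exp w - 1 - w‖ ≤ ‖w‖ ^ 2 * Real.exp ‖w‖ := by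
  have h := Complex.norm_exp_sub_sum_le_norm_mul_exp w 2
  simpa [Finset.sum_range_succ, sub_sub] using h

/-- The phase at the saddle point, normalised to vanish to second order. -/
noncomputable def saddlePhase (α : ℝ) (x : ℂ) : ℂ :=
  Complex.exp (α * x) - 1 - α * (Complex.exp x - 1)

theorem norm_saddlePhase_sub_quadratic_le (hα : 1 < α) {x : ℂ} (hx : α * ‖x‖ ≤ 1) :
    ‖saddlePhase α x - α * (α - 1) / 2 * x ^ 2‖ ≤ 4 / 9 * α ^ 3 * ‖x‖ ^ 3 := by
  have hα0 : 0 < α := by linarith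
  have hn : ‖(α : ℂ) * x‖ = α * ‖x‖ := by simp [abs_of_pos hα0]
  have h1 := norm_cexp_sub_quadratic_le (y := α * x) (by rwa [hn])
  have h2 := norm_cexp_sub_quadratic_le (y := x) (by nlinarith [norm_nonneg x])
  have e : saddlePhase α x - α * (α - 1) / 2 * x ^ 2 =
      (Complex.exp (α * x) - (1 + α * x + (α * x) ^ 2 / 2)) -
      α * (Complex.exp x - (1 + x + x ^ 2 / 2)) := by
    rw [saddlePhase]
    ring
  rw [e]
  refine (norm_sub_le _ _).trans ?_
  rw [norm_mul, Complex.norm_real, Real.norm_of_nonneg hα0.le]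
  rw [hn] at h1
  have h3 : α * (2 / 9 * ‖x‖ ^ 3) ≤ α ^ 3 * (2 / 9 * ‖x‖ ^ 3) := by
    gcongr
    exact le_self_pow₀ hα.le (by norm_num)
  have h4 := mul_le_mul_of_nonneg_left h2 hα0.le
  nlinarith

theorem norm_saddlePhase_sub_cubic_le (hα : 1 < α) {x : ℂ} (hx : α * ‖x‖ ≤ 1) :
    ‖saddlePhase α x - (α * (α - 1) / 2 * x ^ 2 + (α ^ 3 - α) / 6 * x ^ 3)‖ ≤
      2 * α ^ 4 * ‖x‖ ^ 4 := by
  have hα0 : 0 < α := by linarith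
  have hn : ‖(α : ℂ) * x‖ = α * ‖x‖ := by simp [abs_of_pos hα0]
  have h1 := norm_cexp_sub_cubic_le (y := α * x) (by rwa [hn])
  have h2 := norm_cexp_sub_cubic_le (y := x) (by nlinarith [norm_nonneg x])
  have e : saddlePhase α x - (α * (α - 1) / 2 * x ^ 2 + (α ^ 3 - α) / 6 * x ^ 3) =
      (Complex.exp (α * x) - (1 + α * x + (α * x) ^ 2 / 2 + (α * x) ^ 3 / 6)) -
      α * (Complex.exp x - (1 + x + x ^ 2 / 2 + x ^ 3 / 6)) := by
    rw [saddlePhase]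
    ring
  rw [e]
  refine (norm_sub_le _ _).trans ?_
  rw [norm_mul, Complex.norm_real, Real.norm_of_nonneg hα0.le]
  rw [hn] at h1
  have h3 : α * ‖x‖ ^ 4 ≤ α ^ 4 * ‖x‖ ^ 4 := by
    gcongr
    exact le_self_pow₀ hα.le (by norm_num)
  have h4 := mul_le_mul_of_nonneg_left h2 hα0.le
  nlinarith

/-- The odd part of the first-order correction to the Gaussian at the saddle point. -/
noncomputable def saddleCorrection (α : ℝ) (m : ℕ) (l : ℝ) (x : ℂ) : ℂ :=
  m * x + Complex.I * l * ((α ^ 3 - α) / 6 * x ^ 3)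

/-- With `k = α (α - 1) / 8` and `s = l ‖x‖ ^ 2`, the Gaussian on the diagonal is `exp (-4 k s)`.
The remainder `exp ‖w‖` uses up `2 k s` of it and the powers of `s` another `k s`, so a Gaussian
`exp (-k s)` survives. -/
theorem exists_norm_cexp_saddlePhase_sub_le (hα : 1 < α) (m : ℕ) :
    ∃ C, 0 ≤ C ∧ ∀ (l : ℝ) (x : ℂ), 0 < l → 2 * ‖x‖ ≤ 3 * tilt α →
      ‖Complex.exp (saddleCorrection α m l x + Complex.I * l *
          (saddlePhase α x - (α * (α - 1) / 2 * x ^ 2 + (α ^ 3 - α) / 6 * x ^ 3))) -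
        (1 + saddleCorrection α m l x)‖ ≤
      C * (‖x‖ ^ 2 * Real.exp (3 * (α * (α - 1) / 8) * (l * ‖x‖ ^ 2))) := by
  have hα0 : 0 < α := by linarith
  set k := α * (α - 1) / 8 with hk
  have hk0 : 0 < k := div_pos (mul_pos hα0 (by linarith)) (by norm_num)
  refine ⟨Real.exp m * (2 * m ^ 2 + 2 * (α ^ 3) ^ 2 * (2 / k ^ 2)) + 2 * α ^ 4 / k,
    by positivity, fun l x hl hx => ?_⟩
  set q := ‖x‖ with hq
  have hq0 : 0 ≤ q := norm_nonneg x
  have hαq : α * q ≤ 1 := by nlinarith [mul_tilt_lt hα]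
  have hq1 : q ≤ 1 := by nlinarith
  set s := l * q ^ 2 with hs
  have hs0 : 0 ≤ s := by positivity
  set R := saddlePhase α x - (α * (α - 1) / 2 * x ^ 2 + (α ^ 3 - α) / 6 * x ^ 3) with hR
  set w := saddleCorrection α m l x + Complex.I * l * R with hw
  have hwe : w = m * x + Complex.I * l * (saddlePhase α x - α * (α - 1) / 2 * x ^ 2) := by
    rw [hw, saddleCorrection, hR]
    ring
  have hw1 : ‖w‖ ≤ m * q + l * (4 / 9 * α ^ 3 * q ^ 3) := by
    rw [hwe]
    refine (norm_add_le _ _).trans ?_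
    simp only [norm_mul, Complex.norm_natCast, Complex.norm_I, one_mul, Complex.norm_real,
      Real.norm_of_nonneg hl.le]
    gcongr
    exact norm_saddlePhase_sub_quadratic_le hα hαq
  -- The radius `3 / 2 * tilt α` is small enough, as `α ^ 2 * tilt α = (α - 1) / 4`.
  have hcub : 4 / 9 * α ^ 3 * q ≤ 2 * k := by
    have : α ^ 3 * tilt α = α * ((α - 1) / 4) := by rw [← sq_mul_tilt hα]; ring
    have h1 : α ^ 3 * (2 * q) ≤ α ^ 3 * (3 * tilt α) := by gcongr
    rw [hk]
    nlinarith [mul_pos hα0 (sub_pos.2 hα)]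
  have hw2 : ‖w‖ ≤ m + 2 * k * s := by
    refine hw1.trans (add_le_add (mul_le_of_le_one_right m.cast_nonneg hq1) ?_)
    calc l * (4 / 9 * α ^ 3 * q ^ 3) = (4 / 9 * α ^ 3 * q) * s := by rw [hs]; ring
      _ ≤ _ := by gcongr
  have hw3 : ‖w‖ ^ 2 ≤ q ^ 2 * (2 * m ^ 2 + 2 * (α ^ 3) ^ 2 * s ^ 2) := by
    have h1 : l * (4 / 9 * α ^ 3 * q ^ 3) ≤ q * (α ^ 3 * s) := by
      rw [hs]
      have : 0 ≤ l * q ^ 3 * α ^ 3 := by positivity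
      nlinarith
    have h2 : ‖w‖ ≤ q * (m + α ^ 3 * s) := by linarith
    calc ‖w‖ ^ 2 ≤ (q * (m + α ^ 3 * s)) ^ 2 := by gcongr
      _ = q ^ 2 * (m + α ^ 3 * s) ^ 2 := by ring
      _ ≤ _ := by
        gcongr
        nlinarith [sq_nonneg (m - α ^ 3 * s)]
  have hR1 : ‖Complex.I * l * R‖ ≤ q ^ 2 * (2 * α ^ 4 * s) := by
    simp only [norm_mul, Complex.norm_I, one_mul, Complex.norm_real, Real.norm_of_nonneg hl.le]
    calc l * ‖R‖ ≤ l * (2 * α ^ 4 * q ^ 4) := by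
          gcongr
          exact norm_saddlePhase_sub_cubic_le hα hαq
      _ = _ := by rw [hs]; ring
  have hks : 0 ≤ k * s := by positivity
  have hs1 : s ≤ 1 / k * Real.exp (k * s) := by
    rw [div_mul_eq_mul_div, le_div_iff₀ hk0]
    linarith [Real.add_one_le_exp (k * s)]
  have hs2 : s ^ 2 ≤ 2 / k ^ 2 * Real.exp (k * s) := by
    rw [div_mul_eq_mul_div, le_div_iff₀ (by positivity)]
    nlinarith [Real.quadratic_le_exp_of_nonneg hks]
  have hE1 : 1 ≤ Real.exp (k * s) := Real.one_le_exp hks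
  have hE : Real.exp (k * s) ≤ Real.exp (3 * k * s) := Real.exp_le_exp.2 (by nlinarith)
  have e : Complex.exp w - (1 + saddleCorrection α m l x) =
      (Complex.exp w - 1 - w) + Complex.I * l * R := by
    rw [hw]
    ring
  rw [e]
  calc _ ≤ ‖w‖ ^ 2 * Real.exp ‖w‖ + q ^ 2 * (2 * α ^ 4 * s) :=
        (norm_add_le _ _).trans (add_le_add (norm_cexp_sub_one_sub_self_le w) hR1)
    _ ≤ q ^ 2 * (2 * m ^ 2 * Real.exp (k * s) +
          2 * (α ^ 3) ^ 2 * (2 / k ^ 2 * Real.exp (k * s))) *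
          (Real.exp m * Real.exp (2 * k * s)) +
          q ^ 2 * (2 * α ^ 4 * (1 / k * Real.exp (3 * k * s))) := by
      gcongr
      · exact hw3.trans (mul_le_mul_of_nonneg_left (add_le_add
          (le_mul_of_one_le_right (by positivity) hE1) (by gcongr)) (by positivity))
      · rw [← Real.exp_add]
        exact Real.exp_le_exp.2 hw2
      · exact hs1.trans (by gcongr)
    _ = _ := by
      have : Real.exp (3 * k * s) = Real.exp (k * s) * Real.exp (2 * k * s) := by
        rw [← Real.exp_add]
        ring_nf
      rw [this]
      ring

/-- The diagonal is a steepest descent direction: `(1 + i) ^ 2 = 2 i` makes the quadratic phase real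
and negative. -/
theorem oscKernel_saddle_eq (m : ℕ) (l p : ℝ) :
    oscKernel α m l (Complex.I * (α * l : ℝ)) (p * (1 + Complex.I)) =
      Complex.exp (Complex.I * (l * (1 - α) : ℝ)) *
        ((Real.exp (-(α * (α - 1) * l) * p ^ 2) : ℂ) *
        Complex.exp (saddleCorrection α m l (p * (1 + Complex.I)) + Complex.I * l *
          (saddlePhase α (p * (1 + Complex.I)) - (α * (α - 1) / 2 * (p * (1 + Complex.I)) ^ 2 +
            (α ^ 3 - α) / 6 * (p * (1 + Complex.I)) ^ 3)))) := by
  rw [Complex.ofReal_exp, ← Complex.exp_add, ← Complex.exp_add, oscKernel, saddleCorrection,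
    saddlePhase]
  congr 1
  push_cast
  linear_combination (α * (α - 1) / 2 * l * p ^ 2 * (Complex.I + 2) : ℂ) * Complex.I_sq

theorem exists_norm_oscKernel_sub_gaussian_le (hα : 1 < α) (m : ℕ) :
    ∃ C, 0 ≤ C ∧ ∀ l p : ℝ, 0 < l → |p| ≤ tilt α →
      ‖oscKernel α m l (Complex.I * (α * l : ℝ)) (p * (1 + Complex.I)) -
        Complex.exp (Complex.I * (l * (1 - α) : ℝ)) *
        ((Real.exp (-(α * (α - 1) * l) * p ^ 2) : ℂ) *
          (1 + saddleCorrection α m l (p * (1 + Complex.I))))‖ ≤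
      C * (p ^ 2 * Real.exp (-(α * (α - 1) / 4 * l) * p ^ 2)) := by
  obtain ⟨C, hC0, hC⟩ := exists_norm_cexp_saddlePhase_sub_le hα m
  refine ⟨2 * C, by positivity, fun l p hl hp => ?_⟩
  have hx : ‖(p * (1 + Complex.I) : ℂ)‖ ^ 2 = 2 * p ^ 2 := by
    rw [Complex.sq_norm, Complex.normSq_apply]
    simp
    ring
  -- Here `‖1 + I‖ = √2 ≤ 3 / 2`.
  have hx2 : 2 * ‖(p * (1 + Complex.I) : ℂ)‖ ≤ 3 * tilt α := by
    refine abs_le_of_sq_le_sq' ?_ (by linarith [tilt_pos hα]) |>.2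
    have : p ^ 2 ≤ tilt α ^ 2 := by
      rw [← sq_abs p]
      gcongr
    nlinarith
  have h1 := hC l _ hl hx2
  rw [hx] at h1
  rw [oscKernel_saddle_eq, ← mul_sub, ← mul_sub, norm_mul, norm_mul, mul_comm Complex.I,
    Complex.norm_exp_ofReal_mul_I, one_mul, Complex.norm_real, Real.norm_of_nonneg
    (Real.exp_pos _).le]
  refine (mul_le_mul_of_nonneg_left h1 (Real.exp_pos _).le).trans (le_of_eq ?_)
  have : Real.exp (-(α * (α - 1) / 4 * l) * p ^ 2) = Real.exp (-(α * (α - 1) * l) * p ^ 2) *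
      Real.exp (3 * (α * (α - 1) / 8) * (l * (2 * p ^ 2))) := by
    rw [← Real.exp_add]
    ring_nf
  rw [this]
  ring

end Saddle

/-! ### Gaussian evaluation of the saddle contribution. -/

section SaddleAsymptotics

variable {α : ℝ}

theorem integrable_sq_mul_exp_neg_mul_sq {b : ℝ} (hb : 0 < b) :
    Integrable fun p : ℝ => p ^ 2 * Real.exp (-b * p ^ 2) := by
  simpa using integrable_rpow_mul_exp_neg_mul_sq hb (s := 2) (by norm_num)

theorem integral_sq_mul_exp_neg_mul_mul_sq (b : ℝ) {l : ℝ} (hl : 0 < l) :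
    ∫ p : ℝ, p ^ 2 * Real.exp (-(b * l) * p ^ 2) =
      l ^ (-(3 / 2 : ℝ)) * ∫ p : ℝ, p ^ 2 * Real.exp (-b * p ^ 2) := by
  have h := Measure.integral_comp_mul_left (fun p : ℝ => p ^ 2 * Real.exp (-b * p ^ 2))
    (Real.sqrt l)
  have h1 : ∀ p : ℝ, p ^ 2 * Real.exp (-(b * l) * p ^ 2) =
      l⁻¹ * ((Real.sqrt l * p) ^ 2 * Real.exp (-b * (Real.sqrt l * p) ^ 2)) := fun p => by
    rw [mul_pow, Real.sq_sqrt hl.le]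
    field_simp
  simp only [h1]
  rw [integral_const_mul, h, smul_eq_mul, abs_of_nonneg (by positivity), ← mul_assoc]
  congr 1
  rw [show (-(3 / 2) : ℝ) = -1 + -(1 / 2) by norm_num, Real.rpow_add hl, Real.rpow_neg_one,
    Real.rpow_neg hl.le, ← Real.sqrt_eq_rpow]

theorem saddleCorrection_neg (m : ℕ) (l : ℝ) (x : ℂ) :
    saddleCorrection α m l (-x) = -saddleCorrection α m l x := by
  rw [saddleCorrection, saddleCorrection]
  ring

theorem intervalIntegral_eq_zero_of_odd {f : ℝ → ℂ} (hf : ∀ p, f (-p) = -f p) (d : ℝ) :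
    ∫ p in -d..d, f p = 0 := by
  have h := intervalIntegral.integral_comp_neg f (a := -d) (b := d)
  simp only [hf, intervalIntegral.integral_neg, neg_neg] at h
  exact self_eq_neg.1 h.symm

theorem norm_integral_sub_intervalIntegral_gaussian_le {b c d l : ℝ} (hd : 0 < d) (hc : 0 < c)
    (hcb : c ≤ b) (hl : 0 < l) :
    ‖((∫ p : ℝ, Real.exp (-(b * l) * p ^ 2) : ℝ) : ℂ) -
      ∫ p in -d..d, (Real.exp (-(b * l) * p ^ 2) : ℂ)‖ ≤
      1 / d ^ 2 * ∫ p : ℝ, p ^ 2 * Real.exp (-(c * l) * p ^ 2) := by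
  have hi : Integrable fun p : ℝ => Real.exp (-(b * l) * p ^ 2) :=
    integrable_exp_neg_mul_sq (mul_pos (hc.trans_le hcb) hl)
  have hi2 := (integrable_sq_mul_exp_neg_mul_sq (mul_pos hc hl)).const_mul (1 / d ^ 2)
  have h1 := integral_add_compl (s := Set.Ioc (-d) d) measurableSet_Ioc hi
  rw [intervalIntegral.integral_ofReal, intervalIntegral.integral_of_le (by linarith), ← h1,
    ← Complex.ofReal_sub, add_sub_cancel_left, Complex.norm_real, ← integral_const_mul]
  refine (norm_integral_le_of_norm_le hi2.integrableOn ?_).trans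
    (setIntegral_le_integral hi2 (Eventually.of_forall fun p => by
      simp only [Pi.zero_apply]
      positivity))
  filter_upwards [ae_restrict_mem measurableSet_Ioc.compl] with p hp
  have hp2 : d ^ 2 ≤ p ^ 2 := by
    rw [Set.mem_compl_iff, Set.mem_Ioc, not_and_or, not_lt, not_le] at hp
    rcases hp with h | h <;> nlinarith
  rw [Real.norm_eq_abs, Real.abs_exp, ← mul_assoc]
  have h2 : 1 ≤ 1 / d ^ 2 * p ^ 2 := by
    rw [one_div, inv_mul_eq_div, one_le_div (by positivity)]
    exact hp2
  refine le_trans ?_ (le_mul_of_one_le_left (Real.exp_pos _).le h2)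
  rw [Real.exp_le_exp]
  have h3 := mul_le_mul_of_nonneg_right hcb (mul_nonneg hl.le (sq_nonneg p))
  linarith

/-- As `exp p ≥ 1` here, half of the exponent yields `exp (-k l / 2)`, far smaller than the power
kept. -/
theorem exists_integral_Ioi_exp_le {k : ℝ} (hk : 0 < k) {d : ℝ} (hd : 0 ≤ d) (m : ℕ) :
    ∃ C, ∀ l : ℝ, 1 ≤ l → ∫ p in Set.Ioi d, Real.exp (m * p - k * l * Real.exp p) ≤
      C * l ^ (-(3 / 2 : ℝ)) := by
  refine ⟨(2 / (k / 2) ^ 2) * ∫ p in Set.Ioi d, Real.exp (m * p - k / 2 * Real.exp p),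
    fun l hl => ?_⟩
  have hl0 : 0 < l := by linarith
  have h1 : Real.exp (-(k / 2 * l)) ≤ 2 / (k / 2) ^ 2 * l ^ (-(3 / 2 : ℝ)) := by
    have h2 := Real.quadratic_le_exp_of_nonneg (x := k / 2 * l) (by positivity)
    have h3 : l ^ (-2 : ℝ) ≤ l ^ (-(3 / 2 : ℝ)) :=
      Real.rpow_le_rpow_of_exponent_le hl (by norm_num)
    have h4 : l ^ (-2 : ℝ) = (l ^ 2)⁻¹ := by
      rw [Real.rpow_neg hl0.le]
      norm_num
    calc Real.exp (-(k / 2 * l)) ≤ ((k / 2 * l) ^ 2 / 2)⁻¹ := by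
          rw [Real.exp_neg]
          gcongr
          have : 0 < k / 2 * l := by positivity
          linarith
      _ = 2 / (k / 2) ^ 2 * l ^ (-2 : ℝ) := by
          rw [h4]
          field_simp
      _ ≤ _ := by gcongr
  have hi := integrableOn_exp_mul_sub_exp_Ioi (s := m) (c := k / 2) m.cast_nonneg (by positivity) d
  have hi2 := integrableOn_exp_mul_sub_exp_Ioi (s := m) (c := k * l) m.cast_nonneg (by positivity) d
  calc _ ≤ ∫ p in Set.Ioi d, Real.exp (-(k / 2 * l)) * Real.exp (m * p - k / 2 * Real.exp p) := by
        refine setIntegral_mono_on hi2 (hi.const_mul _) measurableSet_Ioi fun p hp => ?_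
        rw [← Real.exp_add, Real.exp_le_exp]
        have h5 : 1 ≤ Real.exp p := Real.one_le_exp (hd.trans (le_of_lt hp))
        nlinarith [mul_nonneg (sub_nonneg.2 hl) (sub_nonneg.2 h5)]
    _ = Real.exp (-(k / 2 * l)) * ∫ p in Set.Ioi d, Real.exp (m * p - k / 2 * Real.exp p) :=
        integral_const_mul _ _
    _ ≤ _ := by
      rw [mul_right_comm]
      gcongr

/-- The leading contribution of the saddle point to the rescaled integral. -/
noncomputable def saddleMain (α l : ℝ) : ℂ :=
  Complex.exp (Complex.I * (l * (1 - α) : ℝ)) *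
    ((Real.sqrt (Real.pi / (α * (α - 1) * l)) : ℂ) * (1 + Complex.I))

/-- The first correction is odd and integrates to zero over the symmetric segment. What remains is
bounded by `p ^ 2` times a Gaussian, hence `l ^ (-3/2)`. -/
theorem exists_norm_saddleArc_sub_saddleMain_le (hα : 1 < α) (m : ℕ) :
    ∃ C, ∀ l : ℝ, 1 ≤ l → ‖saddleArc α m l - saddleMain α l‖ ≤ C * l ^ (-(3 / 2 : ℝ)) := by
  have hd := tilt_pos hα
  have hb : 0 < α * (α - 1) := mul_pos (by linarith) (by linarith)
  obtain ⟨C₁, hC₁0, hC₁⟩ := exists_norm_oscKernel_sub_gaussian_le hα m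
  obtain ⟨C₂, hC₂⟩ := exists_integral_Ioi_exp_le (rightRate_pos hα) hd.le m
  set M := ∫ p : ℝ, p ^ 2 * Real.exp (-(α * (α - 1) / 4) * p ^ 2) with hM
  refine ⟨(C₁ * M + 1 / tilt α ^ 2 * M) * 2 + C₂, fun l hl => ?_⟩
  have hl0 : 0 < l := by linarith
  have hi := integrable_sq_mul_exp_neg_mul_sq (b := α * (α - 1) / 4 * l) (by positivity)
  have hM' := integral_sq_mul_exp_neg_mul_mul_sq (α * (α - 1) / 4) hl0
  rw [← hM] at hM'
  set c : ℂ := Complex.exp (Complex.I * (l * (1 - α) : ℝ)) with hc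
  have hc1 : ‖c‖ = 1 := by rw [hc, mul_comm, Complex.norm_exp_ofReal_mul_I]
  have hI : ‖(1 + Complex.I : ℂ)‖ ≤ 2 := by
    refine (norm_add_le _ _).trans ?_
    simp
    norm_num
  set f : ℝ → ℂ := fun p => oscKernel α m l (Complex.I * (α * l : ℝ)) (p * (1 + Complex.I)) with hf
  set g : ℝ → ℂ := fun p => (Real.exp (-(α * (α - 1) * l) * p ^ 2) : ℂ) with hg
  set w : ℝ → ℂ := fun p => saddleCorrection α m l (p * (1 + Complex.I)) with hw
  have hfc : Continuous f := by fun_prop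
  have hgc : Continuous g := by fun_prop
  have hwc : Continuous w := by
    rw [hw]
    unfold saddleCorrection
    fun_prop
  have h1 : ‖∫ p in -tilt α..tilt α, (f p - c * (g p * (1 + w p)))‖ ≤
      C₁ * M * l ^ (-(3 / 2 : ℝ)) := by
    have h2 : C₁ * M * l ^ (-(3 / 2 : ℝ)) =
        ∫ p : ℝ, C₁ * (p ^ 2 * Real.exp (-(α * (α - 1) / 4 * l) * p ^ 2)) := by
      rw [integral_const_mul, hM']
      ring
    rw [h2, intervalIntegral.integral_of_le (by linarith)]
    refine (norm_integral_le_of_norm_le (hi.const_mul C₁).integrableOn ?_).trans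
      (setIntegral_le_integral (hi.const_mul C₁) (Eventually.of_forall fun p => by
        simp only [Pi.zero_apply]
        positivity))
    filter_upwards [ae_restrict_mem measurableSet_Ioc] with p hp
    exact hC₁ l p hl0 (abs_le.2 ⟨hp.1.le, hp.2⟩)
  have h2 : ∫ p in -tilt α..tilt α, (f p - c * (g p * (1 + w p))) =
      (∫ p in -tilt α..tilt α, f p) - c * ∫ p in -tilt α..tilt α, g p := by
    have hodd : ∫ p in -tilt α..tilt α, g p * w p = 0 := by
      refine intervalIntegral_eq_zero_of_odd (fun p => ?_) _
      simp only [hg, hw, Complex.ofReal_neg, neg_mul _ (1 + Complex.I), saddleCorrection_neg]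
      simp
    rw [intervalIntegral.integral_sub (hfc.intervalIntegrable _ _)
      (Continuous.intervalIntegrable (by fun_prop) _ _), intervalIntegral.integral_const_mul]
    simp only [mul_add, mul_one]
    rw [intervalIntegral.integral_add (hgc.intervalIntegrable _ _)
      (Continuous.intervalIntegrable (by fun_prop) _ _), hodd, add_zero]
  have h3 := norm_integral_sub_intervalIntegral_gaussian_le hd (c := α * (α - 1) / 4)
    (b := α * (α - 1)) (by positivity) (by linarith) hl0
  rw [hM', integral_gaussian] at h3
  have h4 : ‖∫ p in Set.Ioi (tilt α), oscKernel α m l (Complex.I * (α * l : ℝ))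
      (p + Complex.I * tilt α)‖ ≤ C₂ * l ^ (-(3 / 2 : ℝ)) := by
    refine (norm_integral_le_of_norm_le (integrableOn_exp_mul_sub_exp_Ioi (s := m) m.cast_nonneg
      (mul_pos (rightRate_pos hα) hl0) _) ?_).trans (hC₂ l hl)
    filter_upwards [ae_restrict_mem measurableSet_Ioi] with p hp
    exact norm_oscKernel_right_le hα m hl0 (le_of_lt hp)
  have e : saddleArc α m l - saddleMain α l =
      ((∫ p in -tilt α..tilt α, (f p - c * (g p * (1 + w p)))) -
        c * ((Real.sqrt (Real.pi / (α * (α - 1) * l)) : ℂ) - ∫ p in -tilt α..tilt α, g p)) *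
        (1 + Complex.I) + ∫ p in Set.Ioi (tilt α),
          oscKernel α m l (Complex.I * (α * l : ℝ)) (p + Complex.I * tilt α) := by
    rw [h2, saddleArc, saddleMain, intervalIntegral.integral_mul_const]
    ring
  rw [e]
  refine (norm_add_le _ _).trans ?_
  rw [norm_mul, add_mul]
  refine add_le_add ?_ h4
  rw [mul_right_comm (C₁ * M + 1 / tilt α ^ 2 * M)]
  refine mul_le_mul ((norm_sub_le _ _).trans ?_) hI (norm_nonneg _) (by positivity)
  rw [norm_mul, hc1, one_mul, add_mul]
  refine add_le_add h1 (h3.trans (le_of_eq ?_))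
  ring

end SaddleAsymptotics

/-! ### Translation into powers of `t`, and the two signs of `t`. -/

section BoundaryAsymptotics

variable {α : ℝ}

/-- The stationary point of the phase `u ^ α - t u`. -/
noncomputable def stationaryPoint (α t : ℝ) : ℝ := (t / α) ^ (α - 1)⁻¹

theorem stationaryPoint_pos (hα : 1 < α) {t : ℝ} (ht : 0 < t) : 0 < stationaryPoint α t :=
  Real.rpow_pos_of_pos (div_pos ht (by linarith)) _

theorem mul_stationaryPoint_rpow (hα : 1 < α) {t : ℝ} (ht : 0 < t) :
    α * stationaryPoint α t ^ (α - 1) = t := by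
  rw [stationaryPoint, Real.rpow_inv_rpow (div_pos ht (by linarith)).le (by linarith),
    mul_div_cancel₀ _ (by linarith)]

theorem one_le_stationaryPoint_rpow (hα : 1 < α) {t : ℝ} (ht : α ≤ t) :
    1 ≤ stationaryPoint α t ^ α := by
  have h : 1 ≤ t / α := by rwa [one_le_div (by linarith)]
  exact Real.one_le_rpow (Real.one_le_rpow h (inv_nonneg.2 (by linarith))) (by linarith)

theorem stationaryPoint_pow_mul_rpow (hα : 1 < α) (m : ℕ) (k : ℝ) {t : ℝ} (ht : 0 < t) :
    stationaryPoint α t ^ m * (stationaryPoint α t ^ α) ^ k =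
      α ^ (-((m + k * α) / (α - 1))) * t ^ ((m + k * α) / (α - 1)) := by
  have hα0 : 0 < α := by linarith
  have hu := stationaryPoint_pos hα ht
  have hlog : Real.log (stationaryPoint α t) = (Real.log t - Real.log α) / (α - 1) := by
    rw [stationaryPoint, Real.log_rpow (div_pos ht hα0), Real.log_div ht.ne' hα0.ne',
      inv_mul_eq_div]
  rw [← Real.rpow_mul hu.le, ← Real.rpow_natCast, ← Real.rpow_add hu, Real.rpow_def_of_pos hu,
    Real.rpow_def_of_pos hα0, Real.rpow_def_of_pos ht, ← Real.exp_add, hlog]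
  congr 1
  ring

theorem one_add_I_eq : (1 + Complex.I : ℂ) =
    (Real.sqrt 2 : ℂ) * Complex.exp (Complex.I * (Real.pi / 4 : ℝ)) := by
  have h : (Real.sqrt 2 : ℂ) * Real.sqrt 2 = 2 := by
    rw [← Complex.ofReal_mul, Real.mul_self_sqrt (by norm_num)]
    norm_num
  rw [mul_comm Complex.I, Complex.exp_mul_I, ← Complex.ofReal_cos, ← Complex.ofReal_sin,
    Real.cos_pi_div_four, Real.sin_pi_div_four]
  push_cast
  linear_combination (-(1 + Complex.I) / 2) * h

/-- The half comes from the mean of the two conjugate parts, and `1 + i = √2 exp (i π / 4)` supplies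
the phase shift. -/
theorem leadingTerm_eq_saddleMain (hα : 1 < α) (m : ℕ) {t : ℝ} (ht : 0 < t) :
    leadingTerm α m t = (-1) ^ m * ((stationaryPoint α t ^ m : ℝ) *
      saddleMain α (stationaryPoint α t ^ α)) / 2 := by
  have hα0 : 0 < α := by linarith
  have hα1 : 0 < α - 1 := by linarith
  have hu := stationaryPoint_pos hα ht
  set l := stationaryPoint α t ^ α with hl
  have hl0 : 0 < l := Real.rpow_pos_of_pos hu α
  have hphase : constB α * t ^ (α / (α - 1)) = (α - 1) * l := by
    have h := stationaryPoint_pow_mul_rpow hα 0 1 ht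
    rw [pow_zero, one_mul, Real.rpow_one, Nat.cast_zero, zero_add, one_mul] at h
    rw [hl, h, constB]
    ring
  have hamp : α ^ ((1 / 2 - (m : ℝ)) / (α - 1)) * Real.sqrt (Real.pi / (2 * (α - 1))) *
      t ^ (((m : ℝ) - α / 2) / (α - 1)) =
      stationaryPoint α t ^ m * Real.sqrt (Real.pi / (α * (α - 1) * l)) * Real.sqrt 2 / 2 := by
    have h := stationaryPoint_pow_mul_rpow hα m (-(1 / 2)) ht
    rw [← hl] at h
    have h1 : Real.sqrt (Real.pi / (α * (α - 1) * l)) =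
        Real.sqrt (Real.pi / (2 * (α - 1))) * Real.sqrt 2 * α ^ (-(1 / 2) : ℝ) *
          l ^ (-(1 / 2) : ℝ) := by
      rw [Real.rpow_neg hα0.le, Real.rpow_neg hl0.le, ← Real.sqrt_eq_rpow, ← Real.sqrt_eq_rpow,
        ← Real.sqrt_inv, ← Real.sqrt_inv, ← Real.sqrt_mul (by positivity),
        ← Real.sqrt_mul (by positivity), ← Real.sqrt_mul (by positivity)]
      congr 1
      field_simp
    have h2 : Real.sqrt 2 * Real.sqrt 2 = 2 := Real.mul_self_sqrt (by norm_num)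
    have h3 : α ^ ((1 / 2 - (m : ℝ)) / (α - 1)) =
        α ^ (-(1 / 2) : ℝ) * α ^ (-((m + -(1 / 2) * α) / (α - 1))) := by
      rw [← Real.rpow_add hα0]
      congr 1
      field_simp
      ring
    have h4 : ((m : ℝ) - α / 2) / (α - 1) = (m + -(1 / 2) * α) / (α - 1) := by ring
    rw [h1, h3, h4]
    linear_combination (-(Real.sqrt (Real.pi / (2 * (α - 1))) * α ^ (-(1 / 2) : ℝ))) * h -
      (stationaryPoint α t ^ m * Real.sqrt (Real.pi / (2 * (α - 1))) * α ^ (-(1 / 2) : ℝ) *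
          l ^ (-(1 / 2) : ℝ)) / 2 * h2
  have hexp : Complex.exp (-Complex.I * (((α - 1) * l - Real.pi / 4 : ℝ) : ℂ)) =
      Complex.exp (Complex.I * (l * (1 - α) : ℝ)) *
        Complex.exp (Complex.I * (Real.pi / 4 : ℝ)) := by
    rw [← Complex.exp_add]
    congr 1
    push_cast
    ring
  rw [leadingTerm, Real.sign_of_pos ht, one_mul, abs_of_pos ht, hphase, hexp, constA,
    saddleMain, one_add_I_eq, mul_assoc, mul_assoc, ← mul_assoc (α ^ _), hamp]
  push_cast
  ring

/-- Three errors add up: the incoming leg, the saddle expansion, and the non-stationary half. The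
last is `O(t ^ (-(m + 1)))`, which the first power of `l` absorbs. -/
theorem exists_norm_iteratedDeriv_sub_leadingTerm_le (hα : 1 < α) (m : ℕ) :
    ∃ C, 0 ≤ C ∧ ∀ t : ℝ, α ≤ t →
      ‖iteratedDeriv (m + 1) (entireK α) (1 + Complex.I * t) - leadingTerm α (m + 1) t‖ ≤
        C * (stationaryPoint α t ^ (m + 1) *
          ((stationaryPoint α t ^ α) ^ (-((m + 1 : ℕ) : ℝ)) +
            (stationaryPoint α t ^ α) ^ (-(3 / 2 : ℝ)))) := by
  have hα0 : 0 < α := by linarith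
  obtain ⟨C₁, hC₁⟩ := exists_norm_rayMoment_sub_saddleArc_le hα m.succ_ne_zero
  obtain ⟨C₂, hC₂⟩ := exists_norm_saddleArc_sub_saddleMain_le hα (m + 1)
  obtain ⟨C₃, hC₃⟩ := exists_norm_rayMoment_neg_le hα m.succ_ne_zero
  have h1C : 0 ≤ C₁ := by simpa using (norm_nonneg _).trans (hC₁ 1 one_pos)
  have h2C : 0 ≤ C₂ := by simpa using (norm_nonneg _).trans (hC₂ 1 le_rfl)
  have h3C : 0 ≤ C₃ := by simpa using (norm_nonneg _).trans (hC₃ 1 one_pos)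
  refine ⟨C₁ + C₂ + C₃, by positivity, fun t ht => ?_⟩
  have ht0 : 0 < t := by linarith
  have hu := stationaryPoint_pos hα ht0
  set u := stationaryPoint α t with hudef
  have hl := one_le_stationaryPoint_rpow hα ht
  have hl0 : 0 < u ^ α := by linarith
  have b1 := hC₁ u hu
  have b2 := hC₂ (u ^ α) hl
  have b3 := hC₃ t ht0
  rw [hudef, mul_stationaryPoint_rpow hα ht0, ← hudef] at b1
  have b4 : t ^ (-((m + 1 : ℕ) : ℝ)) ≤ u ^ (m + 1) * (u ^ α) ^ (-((m + 1 : ℕ) : ℝ)) := by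
    rw [hudef, stationaryPoint_pow_mul_rpow hα _ _ ht0]
    have e1 : (((m + 1 : ℕ) : ℝ) + -((m + 1 : ℕ) : ℝ) * α) / (α - 1) = -((m + 1 : ℕ) : ℝ) := by
      have : α - 1 ≠ 0 := by linarith
      field_simp
      ring
    rw [e1, neg_neg]
    refine le_mul_of_one_le_left (Real.rpow_pos_of_pos ht0 _).le ?_
    exact Real.one_le_rpow hα.le (Nat.cast_nonneg _)
  rw [iteratedDeriv_entireK hα, leadingTerm_eq_saddleMain hα _ ht0, ← hudef]
  beta_reduce
  rw [add_sub_cancel_left, map_mul, Complex.conj_I, Complex.conj_ofReal, neg_mul]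
  have e : (-1) ^ (m + 1) * (rayMoment α (m + 1) (Complex.I * t) +
      conj (rayMoment α (m + 1) (-(Complex.I * t)))) / 2 -
      (-1) ^ (m + 1) * ((u ^ (m + 1) : ℝ) * saddleMain α (u ^ α)) / 2 =
      (-1) ^ (m + 1) / 2 * ((rayMoment α (m + 1) (Complex.I * t) -
        (u ^ (m + 1) : ℝ) * saddleArc α (m + 1) (u ^ α)) +
        (u ^ (m + 1) : ℝ) * (saddleArc α (m + 1) (u ^ α) - saddleMain α (u ^ α)) +
        conj (rayMoment α (m + 1) (-(Complex.I * t)))) := by ring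
  have hX : 0 ≤ u ^ (m + 1) * (u ^ α) ^ (-((m + 1 : ℕ) : ℝ)) := by positivity
  have hY : 0 ≤ u ^ (m + 1) * (u ^ α) ^ (-(3 / 2 : ℝ)) := by positivity
  have b5 := mul_le_mul_of_nonneg_left b2 (pow_pos hu (m + 1)).le
  have b6 := mul_le_mul_of_nonneg_left b4 h3C
  have hhalf : ‖((-1) ^ (m + 1) / 2 : ℂ)‖ ≤ 1 := by
    simp
    norm_num
  rw [e, norm_mul]
  refine (mul_le_of_le_one_left (norm_nonneg _) hhalf).trans ((norm_add₃_le).trans ?_)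
  rw [norm_mul, Complex.norm_real, Real.norm_of_nonneg (by positivity), RCLike.norm_conj]
  refine (add_le_add (add_le_add b1 b5) (b3.trans b6)).trans ?_
  simp only [Nat.succ_eq_add_one]
  generalize (u ^ α) ^ (-((m + 1 : ℕ) : ℝ)) = x at hX ⊢
  generalize (u ^ α) ^ (-(3 / 2 : ℝ)) = y at hY ⊢
  linarith [mul_nonneg h1C hY, mul_nonneg h2C hX, mul_nonneg h3C hY]

theorem exists_norm_saddleArc_zero_le (hα : 1 < α) :
    ∃ C, 0 ≤ C ∧ ∀ l : ℝ, 1 ≤ l → ‖saddleArc α 0 l‖ ≤ C * l ^ (-(1 / 2 : ℝ)) := by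
  have hb : 0 < α * (α - 1) := mul_pos (by linarith) (by linarith)
  obtain ⟨C, hC⟩ := exists_norm_saddleArc_sub_saddleMain_le hα 0
  have hC0 : 0 ≤ C := by simpa using (norm_nonneg _).trans (hC 1 le_rfl)
  refine ⟨C + Real.sqrt (Real.pi / (α * (α - 1))) * ‖(1 + Complex.I : ℂ)‖, by positivity,
    fun l hl => ?_⟩
  have hl0 : 0 < l := by linarith
  have h1 : ‖saddleMain α l‖ =
      Real.sqrt (Real.pi / (α * (α - 1))) * ‖(1 + Complex.I : ℂ)‖ * l ^ (-(1 / 2 : ℝ)) := by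
    rw [saddleMain, norm_mul, mul_comm Complex.I, Complex.norm_exp_ofReal_mul_I, one_mul, norm_mul,
      Complex.norm_real, Real.norm_of_nonneg (Real.sqrt_nonneg _), ← div_div,
      Real.sqrt_div' _ hl0.le, Real.rpow_neg hl0.le, ← Real.sqrt_eq_rpow]
    ring
  have h2 : l ^ (-(3 / 2 : ℝ)) ≤ l ^ (-(1 / 2 : ℝ)) :=
    Real.rpow_le_rpow_of_exponent_le hl (by norm_num)
  calc ‖saddleArc α 0 l‖ ≤ ‖saddleArc α 0 l - saddleMain α l‖ + ‖saddleMain α l‖ := by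
        simpa using norm_add_le (saddleArc α 0 l - saddleMain α l) (saddleMain α l)
    _ ≤ C * l ^ (-(1 / 2 : ℝ)) + ‖saddleMain α l‖ := by
        gcongr
        exact (hC l hl).trans (by gcongr)
    _ = _ := by
        rw [h1]
        ring

/-- The whole saddle contribution, of size `l ^ (-1/2)`, is an error here and gives the second power
of `t`; both `l ^ (1 - α)` and the non-stationary half give `t ^ (-α)`. In the mean the angles `tilt
α` cancel and `-i π / 2` remains. -/
theorem exists_norm_entireK_sub_le (hα : 1 < α) :
    ∃ C, ∀ t : ℝ, α ≤ t → ‖entireK α (1 + Complex.I * t) - (-(Real.log |t| : ℂ) -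
      (Real.eulerMascheroniConstant : ℂ) - (Real.pi : ℂ) * Complex.I / 2 * (Real.sign t : ℂ))‖ ≤
        C * (|t| ^ (-α) + |t| ^ (-(α / (2 * (α - 1))))) := by
  have hα0 : 0 < α := by linarith
  have hα1 : α - 1 ≠ 0 := by linarith
  obtain ⟨C₁, hC₁⟩ := exists_norm_rayFinitePart_sub_saddleArc_le hα
  obtain ⟨C₂, h2C, hC₂⟩ := exists_norm_saddleArc_zero_le hα
  obtain ⟨C₃, hC₃⟩ := exists_norm_rayFinitePart_neg_sub_le hα
  have h1C : 0 ≤ C₁ := by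
    have := (norm_nonneg _).trans (hC₁ 1 one_pos)
    simp at this
    linarith
  have h3C : 0 ≤ C₃ := by simpa using (norm_nonneg _).trans (hC₃ 1 one_pos)
  set D := α ^ α + α ^ (α / (2 * (α - 1))) with hD
  have hD0 : 0 ≤ D := by positivity
  refine ⟨(C₁ + C₂) * D + C₃, fun t ht => ?_⟩
  have ht0 : 0 < t := by linarith
  have hu := stationaryPoint_pos hα ht0
  have b1 := hC₁ _ hu
  rw [mul_stationaryPoint_rpow hα ht0] at b1
  set u := stationaryPoint α t with hudef
  have hl := one_le_stationaryPoint_rpow hα ht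
  rw [← hudef] at hl
  have hl0 : 0 < u ^ α := by linarith
  have b2 := hC₂ (u ^ α) hl
  have b3 := hC₃ t ht0
  have p1 := stationaryPoint_pow_mul_rpow hα 0 (1 - α) ht0
  have p2 := stationaryPoint_pow_mul_rpow hα 0 (-(1 / 2)) ht0
  rw [pow_zero, one_mul, Nat.cast_zero, zero_add, ← hudef] at p1 p2
  rw [show (1 - α) * α / (α - 1) = -α by field_simp; ring, neg_neg] at p1
  rw [show -(1 / 2) * α / (α - 1) = -(α / (2 * (α - 1))) by field_simp, neg_neg] at p2
  have p3 : (u ^ α)⁻¹ ≤ (u ^ α) ^ (-(1 / 2 : ℝ)) := by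
    rw [← Real.rpow_neg_one]
    exact Real.rpow_le_rpow_of_exponent_le hl (by norm_num)
  rw [p2] at b2 p3
  rw [p1] at b1
  rw [abs_of_pos ht0, Real.sign_of_pos ht0, entireK, add_sub_cancel_left, map_mul,
    Complex.conj_I, Complex.conj_ofReal, neg_mul]
  set X : ℂ := -Real.eulerMascheroniConstant - Real.log t -
    Complex.I * (Real.pi / 2 + tilt α : ℝ) with hX
  set Y : ℂ := -Real.eulerMascheroniConstant - Real.log t -
    Complex.I * (tilt α - Real.pi / 2 : ℝ) with hY
  have e : (rayFinitePart α (Complex.I * t) + conj (rayFinitePart α (-(Complex.I * t)))) / 2 -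
      (-(Real.log t : ℂ) - (Real.eulerMascheroniConstant : ℂ) -
        (Real.pi : ℂ) * Complex.I / 2 * ((1 : ℝ) : ℂ)) =
      1 / 2 * ((rayFinitePart α (Complex.I * t) - X - saddleArc α 0 (u ^ α)) +
        saddleArc α 0 (u ^ α) + conj (rayFinitePart α (-(Complex.I * t)) - Y)) := by
    simp only [hX, hY, map_sub, map_mul, map_neg, Complex.conj_ofReal, Complex.conj_I]
    push_cast
    ring
  set P := t ^ (-α) with hP
  set Q := t ^ (-(α / (2 * (α - 1)))) with hQ
  have hP0 : 0 ≤ P := (Real.rpow_pos_of_pos ht0 _).le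
  have hQ0 : 0 ≤ Q := (Real.rpow_pos_of_pos ht0 _).le
  have q1 : α ^ α * P ≤ D * P := by
    gcongr
    exact le_add_of_nonneg_right (by positivity)
  have q2 : α ^ (α / (2 * (α - 1))) * Q ≤ D * Q := by
    gcongr
    exact le_add_of_nonneg_left (by positivity)
  have hhalf : ‖(1 / 2 : ℂ)‖ ≤ 1 := by norm_num
  rw [e, norm_mul]
  refine (mul_le_of_le_one_left (norm_nonneg _) hhalf).trans ((norm_add₃_le).trans ?_)
  rw [RCLike.norm_conj]
  have r1 := mul_le_mul_of_nonneg_left (p3.trans q2) h1C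
  have r2 := mul_le_mul_of_nonneg_left q1 h1C
  have r3 := mul_le_mul_of_nonneg_left q2 h2C
  have r4 : 0 ≤ C₃ * Q := mul_nonneg h3C hQ0
  have r5 : 0 ≤ C₂ * (D * P) := by positivity
  calc _ ≤ (C₁ * (D * Q) + C₁ * (D * P)) + C₂ * (D * Q) + C₃ * P := by
        refine add_le_add (add_le_add ?_ (b2.trans r3)) b3
        exact b1.trans (add_le_add r1 r2)
    _ ≤ _ := by linarith

theorem isBigO_cocompact_of_neg_eq_conj {f : ℝ → ℂ} {g : ℝ → ℝ} (hf : ∀ t, f (-t) = conj (f t))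
    (hg : ∀ t, g (-t) = g t) {C a : ℝ} (h : ∀ t, a ≤ t → ‖f t‖ ≤ C * g t) :
    f =O[cocompact ℝ] g := by
  have h1 : f =O[atTop] g := by
    refine IsBigO.of_bound |C| ?_
    filter_upwards [eventually_ge_atTop a] with t ht
    refine (h t ht).trans ((le_abs_self _).trans ?_)
    rw [abs_mul, Real.norm_eq_abs]
  rw [cocompact_eq_atBot_atTop, isBigO_sup]
  refine ⟨?_, h1⟩
  have h2 := h1.comp_tendsto tendsto_neg_atBot_atTop
  refine (h2.norm_left.congr (fun t => ?_) hg).of_norm_left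
  simp [hf]

theorem entireK_conj_line (α t : ℝ) : entireK α (1 + Complex.I * ((-t : ℝ) : ℂ)) =
    conj (entireK α (1 + Complex.I * t)) := by
  simp [entireK, add_comm, map_ofNat]

theorem iteratedDeriv_entireK_conj_line (hα : 1 < α) (m : ℕ) (t : ℝ) :
    iteratedDeriv (m + 1) (entireK α) (1 + Complex.I * ((-t : ℝ) : ℂ)) =
      conj (iteratedDeriv (m + 1) (entireK α) (1 + Complex.I * t)) := by
  simp [iteratedDeriv_entireK hα, add_comm, map_ofNat]

theorem leadingTerm_neg (α : ℝ) (m : ℕ) (t : ℝ) :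
    leadingTerm α m (-t) = conj (leadingTerm α m t) := by
  simp [leadingTerm, Real.sign_neg, ← Complex.exp_conj, map_ofNat]

end BoundaryAsymptotics

/-! ### Assembly of the theorem. -/

theorem theorem3p1 (α : ℝ) (hα : 1 < α) :
    ∃ K : ℂ → ℂ,
      -- the finite part exists for `Re s > 1`, and `K` is an entire extension of it
      (∀ s : ℂ, 1 < s.re → HasFinitePart (kernelK α s) (K s)) ∧
      Differentiable ℂ K ∧
      K 1 = ((-Real.eulerMascheroniConstant / α : ℝ) : ℂ) ∧
      -- behaviour of `K (1 + i t)` as `|t| → ∞`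
      (fun t : ℝ => K (1 + Complex.I * (t : ℂ)) -
          (-(Real.log |t| : ℂ) - (Real.eulerMascheroniConstant : ℂ)
            - (Real.pi : ℂ) * Complex.I / 2 * (Real.sign t : ℂ)))
        =O[cocompact ℝ] (fun t : ℝ => |t| ^ (-α) + |t| ^ (-(α / (2 * (α - 1))))) ∧
      -- first derivative
      (fun t : ℝ => deriv K (1 + Complex.I * (t : ℂ)) - leadingTerm α 1 t)
        =O[cocompact ℝ] (fun t : ℝ => |t|⁻¹) ∧
      -- higher derivatives
      ∀ m : ℕ, 2 ≤ m →
        (fun t : ℝ => iteratedDeriv m K (1 + Complex.I * (t : ℂ)) - leadingTerm α m t)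
          =O[cocompact ℝ] (fun t : ℝ => |t| ^ (((m : ℝ) - 3 * α / 2) / (α - 1))) := by
  have hα1 : α - 1 ≠ 0 := by linarith
  refine ⟨entireK α, fun s hs => hasFinitePart_kernelK hα hs, differentiable_entireK hα,
    entireK_one hα, ?_, ?_, fun m hm => ?_⟩
  · obtain ⟨C, hC⟩ := exists_norm_entireK_sub_le hα
    refine isBigO_cocompact_of_neg_eq_conj (fun t => ?_) (fun t => by simp only [abs_neg]) hC
    rw [entireK_conj_line, abs_neg, Real.sign_neg]
    simp [map_ofNat]
    ring
  · obtain ⟨C, hC0, hC⟩ := exists_norm_iteratedDeriv_sub_leadingTerm_le hα 0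
    simp only [zero_add, iteratedDeriv_one, Nat.cast_one, pow_one] at hC
    refine isBigO_cocompact_of_neg_eq_conj (C := C * (2 * α)) (a := α) (fun t => ?_)
      (fun t => by simp only [abs_neg]) fun t ht => (hC t ht).trans ?_
    · have h := iteratedDeriv_entireK_conj_line hα 0 t
      simp only [zero_add, iteratedDeriv_one] at h
      rw [h, leadingTerm_neg, map_sub]
    · have ht0 : 0 < t := by linarith
      have h1 := stationaryPoint_pow_mul_rpow hα 1 (-1) ht0
      rw [pow_one, Nat.cast_one, show (1 + -1 * α) / (α - 1) = -1 by field_simp; ring, neg_neg,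
        Real.rpow_one, Real.rpow_neg_one t] at h1
      -- For the first derivative the incoming leg, `l ^ (-1)`, outweighs the saddle error.
      have h2 : (stationaryPoint α t ^ α) ^ (-(3 / 2 : ℝ)) ≤ (stationaryPoint α t ^ α) ^ (-1 : ℝ) :=
        Real.rpow_le_rpow_of_exponent_le (one_le_stationaryPoint_rpow hα ht) (by norm_num)
      have h3 := mul_le_mul_of_nonneg_left h2 (stationaryPoint_pos hα ht0).le
      rw [abs_of_pos ht0, mul_assoc C]
      refine mul_le_mul_of_nonneg_left ?_ hC0
      linarith
  · obtain ⟨n, rfl⟩ : ∃ n, m = n + 1 := ⟨m - 1, by omega⟩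
    obtain ⟨C, hC0, hC⟩ := exists_norm_iteratedDeriv_sub_leadingTerm_le hα n
    refine isBigO_cocompact_of_neg_eq_conj
      (C := C * (2 * α ^ (-((((n + 1 : ℕ) : ℝ) + -(3 / 2) * α) / (α - 1))))) (a := α) (fun t => ?_)
      (fun t => by simp only [abs_neg]) fun t ht => (hC t ht).trans ?_
    · rw [iteratedDeriv_entireK_conj_line hα, leadingTerm_neg, map_sub]
    · have ht0 : 0 < t := by linarith
      have h1 := stationaryPoint_pow_mul_rpow hα (n + 1) (-(3 / 2)) ht0
      have hm' : (2 : ℝ) ≤ ((n + 1 : ℕ) : ℝ) := by exact_mod_cast hm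
      -- Order at least `2 > 3 / 2` makes the saddle error the larger one.
      have h2 : (stationaryPoint α t ^ α) ^ (-((n + 1 : ℕ) : ℝ)) ≤
          (stationaryPoint α t ^ α) ^ (-(3 / 2 : ℝ)) :=
        Real.rpow_le_rpow_of_exponent_le (one_le_stationaryPoint_rpow hα ht) (by linarith)
      have h3 := mul_le_mul_of_nonneg_left h2 (pow_pos (stationaryPoint_pos hα ht0) (n + 1)).le
      rw [abs_of_pos ht0, mul_assoc C, show (((n + 1 : ℕ) : ℝ) - 3 * α / 2) / (α - 1) =
        (((n + 1 : ℕ) : ℝ) + -(3 / 2) * α) / (α - 1) by ring]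
      refine mul_le_mul_of_nonneg_left ?_ hC0
      linarith
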